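/- **Setting.** A layered DAG with $L\ge 1$ levels has node set $\mathcal V=\bigcup_{\ell=0}^{L}\mathcal V^{(\ell)}$ with $\mathcal V^{(0)}=\{x_1,\dots,x_d\}$ and $\mathcal V^{(L)}=\{v_{\mathrm{out}}\}$, and all its edges go from some $\mathcal V^{(\ell-1)}$ to $\mathcal V^{(\ell)}$. For $v\in\mathcal V^{(\ell)}$, $\ell\ge1$, let $\mathrm{pa}(v)\subseteq\mathcal V^{(\ell-1)}$ be the set of its parents, assumed nonempty, and $d_{\mathrm{in}}(v)=|\mathrm{pa}(v)|$. Given node functions $g_v:\mathbb R^{d_{\mathrm{in}}(v)}\to\mathbb R$, put $G_{x_i}(x)=x_i$ and $G_v(x)=g_v\big((G_u(x))_{u\in\mathrm{pa}(v)}\big)$; the associated sparse compositional function is $f=G_{v_{\mathrm{out}}}$. For every node $v$ at levels $1,\dots,L$ let $\alpha_v=r_v+\beta_v$ with $r_v\in\mathbb N_0$, $\beta_v\in(0,1]$, and let $g_v$ lie in the unit ball of $\mathcal C^{\alpha_v}([-1,1]^{d_{\mathrm{in}}(v)})$: $g_v$ is $r_v$ times continuously differentiable on the cube and $$\sum_{|\gamma|\le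 r_v}\|D^\gamma g_v\|_{L^\infty}+\max_{|\gamma|=r_v}\sup_{x\ne y}\frac{|D^\gamma g_v(x)-D^\gamma g_v(y)|}{\|x-y\|_\infty^{\beta_v}}\le 1 .$$ $\mathcal{NN}(W,D,K)$ is the class of functions $x\mapsto A_D\sigma(A_{D-1}\sigma(\cdots\sigma(A_0x+b_0)\cdots)+b_{D-1})$, $\sigma(t)=\max\{0,t\}$ applied componentwise, whose layer widths (input and output included) are at most $W$ and for which $\|A_D\|_F\prod_{\ell<D}\sqrt{\|A_\ell\|_F^2+\|b_\ell\|_2^2+1}\le K$. Put $M=\max_v\lceil\log_2(d_{\mathrm{in}}(v)+r_v)\rceil$ (maxima over $v$ run over all nodes at levels $1,\dots,L$) and $D=2LM+2L$. **Theorem.** There is a constant $c>0$, depending only on the DAG and the numbers $r_v,\beta_v$, such that for all node functions as above and every real $K\ge1$ there are ReLU networks $\phi_v:\mathbb R^{d_{\mathrm{in}}(v)}\to\mathbb R$ of depth $D/L$, one for each node $v$ at levels $1,\dots,L$, with the following properties. Put $\Phi_{x_i}(x)=x_i$, $\Phi_v(x)=\phi_v\big((\Phi_u(x))_{u\in\mathrm{pa}(v)}\big)$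 and $\phi=\Phi_{v_{\mathrm{out}}}$. 1. For every integer $W\ge d$ with $$W\ \ge\ \max_{v}K^{\frac{2d_{\mathrm{in}}(v)+\alpha_v}{(D+L)d_{\mathrm{in}}(v)+2L}}$$ we have $\phi\in\mathcal{NN}(W,D,K)$. 2. For every node $v$, $\ \|g_v-\phi_v\|_{L^\infty([-1,1]^{d_{\mathrm{in}}(v)})}\le c\,K^{-\frac{2\alpha_v}{2L+(D+L)d_{\mathrm{in}}(v)}}$. 3. For $x\in[-1,1]^d$, call $\pi=(v^{(1)},\dots,v^{(L)})$, $v^{(L)}=v_{\mathrm{out}}$, a critical path at $x$ if, for each $1\le\ell<L$, $v^{(\ell)}$ maximizes the error $|G_u(x)-\Phi_u(x)|$ among the parents $u$ of $v^{(\ell+1)}$. For every $x\in[-1,1]^d$ and every critical path $\pi$ at $x$, $$|f(x)-\phi(x)|\ \le\ c\max_{1\le\ell\le L}K^{-\frac{2\alpha^*_{v^{(\ell)}}}{2L+(D+L)d_{\mathrm{in}}(v^{(\ell)})}},\qquad \alpha^*_{v^{(\ell)}}=\alpha_{v^{(\ell)}}\prod_{m=\ell+1}^{L}\min\{\alpha_{v^{(m)}},1\}.$$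 There are also a point $x_0\in[-1,1]^d$ at which $|f-\phi|$ attains its maximum and a critical path $\pi$ at $x_0$ for which this right-hand side bounds $\|f-\phi\|_{L^\infty([-1,1]^d)}$. -/

import Mathlib

noncomputable section

/-- The cube `[-1,1]^n`; `Fin n → ℝ` carries the sup norm. -/
def cube (n : ℕ) : Set (Fin n → ℝ) := Set.Icc (fun _ => -1) (fun _ => 1)

/-- The partial derivative `∂_i h` on the closed cube (one-sided at the boundary). -/
def cubePartial {n : ℕ} (i : Fin n) (h : (Fin n → ℝ) → ℝ) : (Fin n → ℝ) → ℝ :=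
  fun x => fderivWithin ℝ h (cube n) x (Pi.single i 1)

/-- The mixed partial derivative `D^γ h = ∂_1^{γ_1} ⋯ ∂_n^{γ_n} h` on the cube. -/
def mixedPartial {n : ℕ} (γ : Fin n → ℕ) (h : (Fin n → ℝ) → ℝ) : (Fin n → ℝ) → ℝ :=
  (List.finRange n).foldr (fun i u => (cubePartial i)^[γ i] u) h

/-- The Hölder norm of order `r + β` on the cube, with values in `[0,∞]`:
the sum over `|γ| ≤ r` of the sup norms of `D^γ h`, plus the largest over `|γ| = r` of the
`β`-Hölder seminorms of `D^γ h` with respect to the sup distance. -/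
def holderNorm {n : ℕ} (r : ℕ) (β : ℝ) (h : (Fin n → ℝ) → ℝ) : ENNReal :=
  (∑ k ∈ Finset.range (r + 1), ∑ γ ∈ Finset.piAntidiag (Finset.univ : Finset (Fin n)) k,
      ⨆ x ∈ cube n, ENNReal.ofReal |mixedPartial γ h x|) +
    ⨆ γ ∈ Finset.piAntidiag (Finset.univ : Finset (Fin n)) r,
      ⨆ x ∈ cube n, ⨆ y ∈ cube n, ⨆ _ : x ≠ y,
        ENNReal.ofReal (|mixedPartial γ h x - mixedPartial γ h y| / ‖x - y‖ ^ β)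

/-- The unit ball of the Hölder space `C^{r+β}([-1,1]^n)`. -/
def HolderUnitBall {n : ℕ} (r : ℕ) (β : ℝ) (h : (Fin n → ℝ) → ℝ) : Prop :=
  ContDiffOn ℝ (r : WithTop ℕ∞) h (cube n) ∧ holderNorm r β h ≤ 1

/-- Parameters of a ReLU network `A_D σ(A_{D-1} σ(⋯ σ(A_0 x + b_0) ⋯) + b_{D-1})` with `D` hidden
layers, from `ℝ^m` to `ℝ^k`. The constructor `layer` adds a first hidden layer. -/
inductive ReLUNet (k : ℕ) : ℕ → ℕ → Type
  | linear {m : ℕ} (A : Matrix (Fin k) (Fin m) ℝ) : ReLUNet k m 0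
  | layer {m n D : ℕ} (A : Matrix (Fin n) (Fin m) ℝ) (b : Fin n → ℝ) (rest : ReLUNet k n D) :
      ReLUNet k m (D + 1)

/-- Frobenius norm of a matrix. -/
def frobNorm {m n : ℕ} (A : Matrix (Fin m) (Fin n) ℝ) : ℝ :=
  Real.sqrt (∑ i, ∑ j, |A i j| ^ 2)

namespace ReLUNet

/-- The function realized by the network. -/
def realize {k : ℕ} : {m D : ℕ} → ReLUNet k m D → (Fin m → ℝ) → (Fin k → ℝ)
  | _, _, linear A, x => A.mulVec x
  | _, _, layer A b rest, x => rest.realize (fun i => max 0 (A.mulVec x i + b i))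

/-- The largest layer width, input and output layers included. -/
def width {k : ℕ} : {m D : ℕ} → ReLUNet k m D → ℕ
  | m, _, linear _ => max m k
  | m, _, layer _ _ rest => max m rest.width

/-- `κ(θ) = ‖A_D‖_F ∏_{ℓ<D} √(‖A_ℓ‖_F² + ‖b_ℓ‖₂² + 1)`. -/
def kappa {k : ℕ} : {m D : ℕ} → ReLUNet k m D → ℝ
  | _, _, linear A => frobNorm A
  | _, _, layer A b rest => Real.sqrt (frobNorm A ^ 2 + (∑ i, |b i| ^ 2) + 1) * rest.kappa

end ReLUNet

/-- The class `NN(W, D, K)` of functions `ℝ^m → ℝ^k` realized by ReLU networks of depth `D`,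
with all layer widths at most `W` and `κ(θ) ≤ K`. -/
def NNClass (m k W D : ℕ) (K : ℝ) : Set ((Fin m → ℝ) → (Fin k → ℝ)) :=
  {φ | ∃ θ : ReLUNet k m D, θ.width ≤ W ∧ θ.kappa ≤ K ∧ θ.realize = φ}

/-- A layered directed acyclic graph with levels `0, …, L`: level `ℓ` has `card ℓ` nodes, edges join
consecutive levels, and level `L` has a single node. Level `0` consists of the input coordinates.
(Levels above `L` are never used.) -/
structure LayeredDAG (L : ℕ) where
  card : ℕ → ℕ
  card_top : card L = 1
  edges : ∀ ℓ, Finset (Fin (card ℓ) × Fin (card (ℓ + 1)))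

namespace LayeredDAG

variable {L : ℕ} (G : LayeredDAG L)

/-- The output node. -/
def out : Fin (G.card L) := ⟨0, by rw [G.card_top]; exact Nat.one_pos⟩

/-- The parents, at level `ℓ`, of a node `v` at level `ℓ + 1`. -/
def parents (ℓ : ℕ) (v : Fin (G.card (ℓ + 1))) : Finset (Fin (G.card ℓ)) :=
  Finset.univ.filter (fun u => (u, v) ∈ G.edges ℓ)

/-- `d_in(v)` for a node `v` at level `ℓ + 1`. -/
def inDim (ℓ : ℕ) (v : Fin (G.card (ℓ + 1))) : ℕ := (G.parents ℓ v).card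

/-- The `i`-th parent of `v`, in increasing order. -/
def parent (ℓ : ℕ) (v : Fin (G.card (ℓ + 1))) (i : Fin (G.inDim ℓ v)) : Fin (G.card ℓ) :=
  (G.parents ℓ v).orderEmbOfFin rfl i

/-- A family of local functions `g_v : ℝ^{d_in(v)} → ℝ`, for the nodes `v` at levels `ℓ + 1 ≥ 1`. -/
abbrev NodeFunctions : Type :=
  ∀ (ℓ : ℕ) (v : Fin (G.card (ℓ + 1))), (Fin (G.inDim ℓ v) → ℝ) → ℝ

/-- The values of all nodes at a given level, on the input `x`. -/
def nodeValue (g : G.NodeFunctions) (x : Fin (G.card 0) → ℝ) : (ℓ : ℕ) → Fin (G.card ℓ) → ℝ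
  | 0 => x
  | ℓ + 1 => fun v => g ℓ v (fun i => nodeValue g x ℓ (G.parent ℓ v i))

/-- The compositional function `ℝ^d → ℝ`, with `d = card 0`, given by the local functions `g`. -/
def compositional (g : G.NodeFunctions) (x : Fin (G.card 0) → ℝ) : ℝ :=
  G.nodeValue g x L G.out

/-- The maximum of `⌈log₂(d_in(v) + r_v)⌉` over all nodes at levels `1, …, L`. -/
def maxLog (r : ∀ ℓ, Fin (G.card (ℓ + 1)) → ℕ) : ℕ :=
  (Finset.range L).sup fun ℓ => Finset.univ.sup fun v => Nat.clog 2 (G.inDim ℓ v + r ℓ v)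

/-- The depth `D` of the whole network. -/
def depth (r : ∀ ℓ, Fin (G.card (ℓ + 1)) → ℕ) : ℕ := 2 * L * G.maxLog r + 2 * L

/-- The depth `D / L` of the block that replaces one node. -/
def blockDepth (r : ∀ ℓ, Fin (G.card (ℓ + 1)) → ℕ) : ℕ := 2 * G.maxLog r + 2

/-- The local functions realized by scalar network blocks, one for each node. -/
def blockFunctions {B : ℕ} (θ : ∀ ℓ (v : Fin (G.card (ℓ + 1))), ReLUNet 1 (G.inDim ℓ v) B) :
    G.NodeFunctions :=
  fun ℓ v y => (θ ℓ v).realize y 0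

/-- The denominator `2L + (D + L) d_in(v)` for a node `v` at level `ℓ + 1`. -/
def denom (r : ∀ ℓ, Fin (G.card (ℓ + 1)) → ℕ) (ℓ : ℕ) (v : Fin (G.card (ℓ + 1))) : ℝ :=
  2 * (L : ℝ) + ((G.depth r : ℝ) + (L : ℝ)) * (G.inDim ℓ v : ℝ)

/-- A choice of one node in each of the levels `1, …, L`. -/
abbrev NodePath : Type := ∀ ℓ : Fin L, Fin (G.card (ℓ.1 + 1))

/-- `π` is a critical path at the input `x` for the approximation of the local functions `g` by `φ`:
tracing back from the output node, the next node is a parent of the current one with the largest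
error `|G_u(x) - Φ_u(x)|` among all parents `u`. -/
def IsCriticalPath (g φ : G.NodeFunctions) (x : Fin (G.card 0) → ℝ) (π : G.NodePath) : Prop :=
  ∀ (ℓ : ℕ) (h : ℓ + 1 < L),
    π ⟨ℓ, Nat.lt_of_succ_lt h⟩ ∈ G.parents (ℓ + 1) (π ⟨ℓ + 1, h⟩) ∧
    ∀ u ∈ G.parents (ℓ + 1) (π ⟨ℓ + 1, h⟩),
      |G.nodeValue g x (ℓ + 1) u - G.nodeValue φ x (ℓ + 1) u| ≤
        |G.nodeValue g x (ℓ + 1) (π ⟨ℓ, Nat.lt_of_succ_lt h⟩)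
          - G.nodeValue φ x (ℓ + 1) (π ⟨ℓ, Nat.lt_of_succ_lt h⟩)|

/-- The effective regularity `α*_v = α_v ∏_{m > ℓ} min (α_{v^{(m)}}, 1)` along the path `π`, for the
node `v` of `π` at level `ℓ + 1`. -/
def effReg (α : ∀ ℓ, Fin (G.card (ℓ + 1)) → ℝ) (π : G.NodePath) (ℓ : Fin L) : ℝ :=
  α ℓ (π ℓ) * ∏ m ∈ Finset.Ioi ℓ, min (α m (π m)) 1

/-- The rate along a path: the maximum over the nodes `v` of `π` of
`K ^ (-2 α*_v / (2L + (D + L) d_in(v)))`. -/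
def pathRate (r : ∀ ℓ, Fin (G.card (ℓ + 1)) → ℕ) (α : ∀ ℓ, Fin (G.card (ℓ + 1)) → ℝ)
    (K : ℝ) (π : G.NodePath) : ℝ :=
  ⨆ ℓ : Fin L, K ^ (-(2 * G.effReg α π ℓ / G.denom r ℓ (π ℓ)))

end LayeredDAG

end

/-! Each block is a glued sum of local Taylor polynomials. On a grid of mesh 1/N in the cube, a
function of smoothness α = r + β differs by order N^(-α) from its Taylor polynomial at a grid point
within distance 1/N (`HolderTower.exists_taylor`), and products of hat functions form a partition of
unity that glues these polynomials. Each term is a product of at most d + r ≤ 2^M factors,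
multiplied pairwise along a binary tree by a gate of precision 1/m², one hidden layer per level of
the tree. The gate is exactly 0 when a factor is 0, so at any x only boundedly many terms are active
and the gate errors do not add up over the N^d grid points. A final truncation keeps values in
[-1,1] (`exists_block_approx`).

The rates come from counting layer norms. The parameter m is free: weights of order 1/√m into a gate
are balanced against weights of order 1/√m out of it (`ReadoutNet.mul`). The N^d terms in parallel
cost N^(d/2) per layer. The slope N of the hats is spread, by homogeneity of ReLU, over all 2M + 3
matrices of a block and costs N^(1/(2M+3)) in each (`UnifNet.rescale`). Between levels of the graph
the last matrix of one block merges with the first of the next (`NormNet.append`). Up to constants,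
L levels multiply to N^(q/2) with q = 2L + (D + L)d. So N ≈ K^(2/q), and m ≈ N^(α/2) balances the
two errors at K^(-2α/q), with width N^d m ≈ K^((2d+α)/q) (`exists_resolution`). Each node has its
own N and q, but the layer norm is always of order K^(1/(L(2M+3))), so blocks of different nodes fit
side by side. Constants are absorbed by building the network for the budget K/K₀; below K₀ the zero
network is good enough (`LayeredDAG.exists_blocks`).

For the composed error, insert g_v evaluated at the approximate parent values: the error E of the
worst parent contributes at most C E^min(α,1), and the block adds its own error. Following the worst
parent back gives a critical path; at each level the larger of the two contributions is kept, at the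
price of a factor 2C (`LayeredDAG.abs_nodeValue_sub_le`). -/

/-! ### Networks over arbitrary finite index types -/

/-- `f` is realized by a ReLU network with `D` hidden layers of width at most `w`, each of whose
layers `(A, b)` satisfies `‖A‖_F² + ‖b‖² + 1 ≤ R²`, and whose last matrix has `‖A‖_F ≤ R`. -/
def UnifNet (R : ℝ) (w : ℕ) {κ : Type} [Fintype κ] :
    (D : ℕ) → (ι : Type) → [Fintype ι] → ((ι → ℝ) → κ → ℝ) → Prop
  | 0, ι, _, f => ∃ A : Matrix κ ι ℝ, ∑ i, ∑ j, A i j ^ 2 ≤ R ^ 2 ∧ f = A.mulVec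
  | D + 1, ι, _, f => ∃ (ν : Type) (_ : Fintype ν) (A : Matrix ν ι ℝ) (b : ν → ℝ)
      (g : (ν → ℝ) → κ → ℝ), Fintype.card ν ≤ w ∧
        ∑ i, ∑ j, A i j ^ 2 + ∑ i, b i ^ 2 + 1 ≤ R ^ 2 ∧ UnifNet R w D ν g ∧
        f = fun x => g fun i => max 0 (A.mulVec x i + b i)

/-- `f` is realized by a ReLU network with `D` hidden layers of width at most `w`, for which the
product of the layer norms is at most `K`. -/
def NormNet (w : ℕ) {κ : Type} [Fintype κ] :
    (K : ℝ) → (D : ℕ) → (ι : Type) → [Fintype ι] → ((ι → ℝ) → κ → ℝ) → Prop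
  | K, 0, ι, _, f => 1 ≤ K ∧ ∃ A : Matrix κ ι ℝ, ∑ i, ∑ j, A i j ^ 2 ≤ K ^ 2 ∧ f = A.mulVec
  | K, D + 1, ι, _, f => ∃ (ν : Type) (_ : Fintype ν) (A : Matrix ν ι ℝ) (b : ν → ℝ)
      (g : (ν → ℝ) → κ → ℝ) (R K' : ℝ), Fintype.card ν ≤ w ∧ 1 ≤ R ∧
        ∑ i, ∑ j, A i j ^ 2 + ∑ i, b i ^ 2 + 1 ≤ R ^ 2 ∧ R * K' ≤ K ∧ NormNet w K' D ν g ∧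
        f = fun x => g fun i => max 0 (A.mulVec x i + b i)

theorem UnifNet.mono {R R' : ℝ} {w w' : ℕ} {κ : Type} [Fintype κ] (hR : 0 ≤ R) (hRR : R ≤ R')
    (hw : w ≤ w') {D : ℕ} : ∀ {ι : Type} [Fintype ι] {f : (ι → ℝ) → κ → ℝ},
      UnifNet R w D ι f → UnifNet R' w' D ι f := by
  have h2 : R ^ 2 ≤ R' ^ 2 := by gcongr
  induction D with
  | zero =>
    rintro ι _ f ⟨A, hA, rfl⟩
    exact ⟨A, hA.trans h2, rfl⟩
  | succ D ih =>
    rintro ι _ f ⟨ν, _, A, b, g, hc, hA, hg, rfl⟩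
    exact ⟨ν, _, A, b, g, hc.trans hw, hA.trans h2, ih hg, rfl⟩

theorem NormNet.one_le {w : ℕ} {κ : Type} [Fintype κ] {D : ℕ} :
    ∀ {K : ℝ} {ι : Type} [Fintype ι] {f : (ι → ℝ) → κ → ℝ}, NormNet w K D ι f → 1 ≤ K := by
  induction D with
  | zero => rintro K ι _ f ⟨h, _⟩; exact h
  | succ D ih =>
    rintro K ι _ f ⟨ν, _, A, b, g, R, K', hc, hR, hA, hK, hg, rfl⟩
    have := ih hg
    nlinarith

theorem NormNet.mono {w : ℕ} {κ : Type} [Fintype κ] {D : ℕ} {K K' : ℝ} (hKK : K ≤ K')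
    {ι : Type} [Fintype ι] {f : (ι → ℝ) → κ → ℝ} (h : NormNet w K D ι f) :
    NormNet w K' D ι f := by
  have hK := h.one_le
  cases D with
  | zero =>
    obtain ⟨-, A, hA, hf⟩ := h
    exact ⟨hK.trans hKK, A, hA.trans (by gcongr), hf⟩
  | succ D =>
    obtain ⟨ν, _, A, b, g, R, K₁, hc, hR, hA, hK₁, hg, hf⟩ := h
    exact ⟨ν, _, A, b, g, R, K₁, hc, hR, hA, hK₁.trans hKK, hg, hf⟩

theorem UnifNet.normNet {R : ℝ} {w : ℕ} {κ : Type} [Fintype κ] (hR : 1 ≤ R) {D : ℕ} :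
    ∀ {ι : Type} [Fintype ι] {f : (ι → ℝ) → κ → ℝ},
      UnifNet R w D ι f → NormNet w (R ^ (D + 1)) D ι f := by
  induction D with
  | zero =>
    rintro ι _ f ⟨A, hA, rfl⟩
    exact ⟨by simpa using hR, A, by simpa using hA, rfl⟩
  | succ D ih =>
    rintro ι _ f ⟨ν, _, A, b, g, hc, hA, hg, rfl⟩
    exact ⟨ν, _, A, b, g, R, R ^ (D + 1), hc, hR, hA, by rw [pow_succ' R (D + 1)], ih hg, rfl⟩

/-- Submultiplicativity of the Frobenius norm. -/
theorem sum_sq_mul_le {ι κ μ : Type} [Fintype ι] [Fintype κ] [Fintype μ]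
    (A : Matrix μ κ ℝ) (B : Matrix κ ι ℝ) :
    ∑ i, ∑ j, (A * B) i j ^ 2 ≤ (∑ i, ∑ k, A i k ^ 2) * ∑ k, ∑ j, B k j ^ 2 := by
  calc ∑ i, ∑ j, (A * B) i j ^ 2
      ≤ ∑ i, ∑ j, (∑ k, A i k ^ 2) * ∑ k, B k j ^ 2 := by
        refine Finset.sum_le_sum fun i _ => Finset.sum_le_sum fun j _ => ?_
        rw [Matrix.mul_apply]
        exact Finset.sum_mul_sq_le_sq_mul_sq _ _ _
    _ = _ := by
        rw [Finset.sum_comm (s := Finset.univ (α := κ)), Finset.sum_mul_sum]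

/-- No activation follows the output matrix of `f`, so it can be multiplied into the first matrix of
`h`: hidden depths add exactly. The induction peels the hidden layers of `f` until only that matrix
is left. -/
theorem NormNet.append {R K : ℝ} {w : ℕ} {κ μ : Type} [Fintype κ] [Fintype μ] (hR : 1 ≤ R)
    {D₁ D₂ : ℕ} {h : (κ → ℝ) → μ → ℝ} (hh : UnifNet R w D₂ κ h) :
    ∀ {ι : Type} [Fintype ι] {f : (ι → ℝ) → κ → ℝ}, NormNet w K D₁ ι f →
      NormNet w (K * R ^ (D₂ + 1)) (D₂ + D₁) ι (fun x => h (f x)) := by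
  induction D₁ generalizing K with
  | zero =>
    rintro ι _ f ⟨hK, A, hA, rfl⟩
    cases D₂ with
    | zero =>
      obtain ⟨C, hC, rfl⟩ := hh
      refine ⟨by simpa using one_le_mul_of_one_le_of_one_le hK hR, C * A, ?_, ?_⟩
      · refine (sum_sq_mul_le C A).trans ?_
        rw [mul_pow, mul_comm]
        simp only [zero_add, pow_one]
        gcongr
      · ext x : 1
        rw [Matrix.mulVec_mulVec]
    | succ D =>
      obtain ⟨ν, _, C, b, g, hc, hC, hg, rfl⟩ := hh
      refine ⟨ν, _, C * A, b, g, K * R, R ^ (D + 1), hc,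
        one_le_mul_of_one_le_of_one_le hK hR, ?_, ?_, hg.normNet hR, ?_⟩
      · have h1 := sum_sq_mul_le C A
        have h2 : (∑ i, ∑ k, C i k ^ 2) * ∑ k, ∑ j, A k j ^ 2 ≤ (∑ i, ∑ k, C i k ^ 2) * K ^ 2 := by
          gcongr
        have h3 : 0 ≤ ∑ i, b i ^ 2 := by positivity
        -- Only the matrix picks up the factor `K ^ 2`; the bias and the `+ 1` do not need it, and
        -- are enlarged by it.
        have h4 : 1 ≤ K ^ 2 := one_le_pow₀ hK
        have h5 : (∑ i, ∑ k, C i k ^ 2 + ∑ i, b i ^ 2 + 1) * K ^ 2 ≤ R ^ 2 * K ^ 2 := by gcongr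
        rw [mul_pow]
        nlinarith
      · rw [pow_succ' R (D + 1)]
        linarith
      · ext x : 1
        simp [Matrix.mulVec_mulVec]
  | succ D ih =>
    rintro ι _ f ⟨ν, _, A, b, g, R', K', hc, hR', hA, hK, hg, rfl⟩
    refine ⟨ν, _, A, b, fun x => h (g x), R', K' * R ^ (D₂ + 1), hc, hR', hA, ?_, ih hg, rfl⟩
    rw [← mul_assoc]
    gcongr

theorem normNet_id {w : ℕ} {ι : Type} [Fintype ι] [Nonempty ι] :
    NormNet w (Fintype.card ι : ℝ) 0 ι (fun x => x) := by
  classical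
  have h1 : (1 : ℝ) ≤ Fintype.card ι := by exact_mod_cast Fintype.card_pos
  refine ⟨h1, 1, ?_, by ext x : 1; simp⟩
  simp only [Matrix.one_apply, ite_pow, one_pow, ne_eq, OfNat.ofNat_ne_zero, not_false_eq_true,
    zero_pow, Finset.sum_ite_eq, Finset.mem_univ, if_true, Finset.sum_const, Finset.card_univ,
    nsmul_eq_mul, mul_one]
  nlinarith

/-- Enumerating the index types turns abstract networks, whose layers are conveniently indexed by
products and sigma types, into `ReLUNet`. The bound `w` concerns hidden layers only, so the input
and output widths enter through the maximum. -/
theorem NormNet.exists_reLUNet {w k : ℕ} {κ : Type} [Fintype κ] (eκ : κ ≃ Fin k) {D : ℕ} :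
    ∀ {K : ℝ} {ι : Type} [Fintype ι] {f : (ι → ℝ) → κ → ℝ}, NormNet w K D ι f →
      ∀ {m : ℕ} (e : ι ≃ Fin m), ∃ θ : ReLUNet k m D,
        θ.width ≤ max m (max w k) ∧ θ.kappa ≤ K ∧
          ∀ x, θ.realize x = fun i => f (fun j => x (e j)) (eκ.symm i) := by
  induction D with
  | zero =>
    rintro K ι _ f ⟨hK, A, hA, rfl⟩ m e
    refine ⟨.linear (Matrix.of fun i j => A (eκ.symm i) (e.symm j)), ?_, ?_, ?_⟩
    · simp only [ReLUNet.width]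
      exact max_le_max_left _ (le_max_right _ _)
    · refine Real.sqrt_le_iff.2 ⟨by linarith, le_trans (le_of_eq ?_) hA⟩
      rw [← eκ.symm.sum_comp]
      refine Finset.sum_congr rfl fun i _ => ?_
      rw [← e.symm.sum_comp]
      simp
    · intro x
      ext i
      simp only [ReLUNet.realize, Matrix.mulVec, dotProduct, Matrix.of_apply]
      rw [← e.sum_comp]
      simp
  | succ D ih =>
    rintro K ι _ f ⟨ν, _, A, b, g, R, K', hc, hR, hA, hK, hg, rfl⟩ m e
    let eν := Fintype.equivFin ν
    obtain ⟨θ, h1, h2, h3⟩ := ih hg eν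
    refine ⟨.layer (Matrix.of fun i j => A (eν.symm i) (e.symm j)) (fun i => b (eν.symm i)) θ,
      ?_, ?_, ?_⟩
    · simp only [ReLUNet.width]
      refine max_le (le_max_left _ _) (h1.trans ?_)
      exact max_le (hc.trans (by simp)) (le_max_right _ _)
    · simp only [ReLUNet.kappa]
      refine le_trans ?_ hK
      have hK' : 0 ≤ K' := by linarith [hg.one_le]
      have h4 : frobNorm (Matrix.of fun i j => A (eν.symm i) (e.symm j)) ^ 2
          = ∑ i, ∑ j, A i j ^ 2 := by
        rw [frobNorm, Real.sq_sqrt (by positivity), ← eν.symm.sum_comp]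
        refine Finset.sum_congr rfl fun i _ => ?_
        rw [← e.symm.sum_comp]
        simp
      have h5 : ∑ i, |b (eν.symm i)| ^ 2 = ∑ i, b i ^ 2 := by
        rw [← eν.symm.sum_comp]
        simp
      rw [h4, h5]
      have h6 : √(∑ i, ∑ j, A i j ^ 2 + ∑ i, b i ^ 2 + 1) ≤ R :=
        Real.sqrt_le_iff.2 ⟨by linarith, hA⟩
      exact (mul_le_mul_of_nonneg_left h2 (Real.sqrt_nonneg _)).trans
        (mul_le_mul_of_nonneg_right h6 hK')
    · intro x
      simp only [ReLUNet.realize]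
      rw [h3]
      ext i
      congr 1
      ext j
      simp only [Matrix.mulVec, dotProduct, Matrix.of_apply]
      rw [← e.sum_comp]
      simp

/-! ### Parallel networks, rescaling, linear functionals and truncation. -/

theorem sum_sq_extend {ι κ : Type} [Fintype ι] [Fintype κ] {p : ι → κ} (hp : p.Injective)
    (a : ι → ℝ) : ∑ k, Function.extend p a 0 k ^ 2 = ∑ i, a i ^ 2 := by
  classical
  symm
  refine Finset.sum_of_injOn p hp.injOn (by simp) ?_ ?_
  · intro k _ hk
    rw [Function.extend_apply' _ _ _ (by simpa using hk)]
    simp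
  · intro i _
    rw [hp.extend_apply]

theorem sum_extend_mul {ι κ : Type} [Fintype ι] [Fintype κ] {p : ι → κ} (hp : p.Injective)
    (a : ι → ℝ) (x : κ → ℝ) : ∑ k, Function.extend p a 0 k * x k = ∑ i, a i * x (p i) := by
  classical
  symm
  refine Finset.sum_of_injOn p hp.injOn (by simp) ?_ ?_
  · intro k _ hk
    rw [Function.extend_apply' _ _ _ (by simpa using hk)]
    simp
  · intro i _
    rw [hp.extend_apply]

/-- Parallel networks reading from possibly overlapping sets of input coordinates. -/
theorem UnifNet.parallel {V : Type} [Fintype V] {R S : ℝ} {w : V → ℕ}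
    (hS : (Fintype.card V : ℝ) * R ^ 2 ≤ S ^ 2) (hS1 : 1 ≤ S) {D : ℕ} :
    ∀ {ι : Type} [Fintype ι] {ιv : V → Type} [∀ v, Fintype (ιv v)]
      {p : ∀ v, ιv v → ι} (_ : ∀ v, (p v).Injective) {f : ∀ v, (ιv v → ℝ) → Unit → ℝ},
      (∀ v, UnifNet R (w v) D (ιv v) (f v)) →
      UnifNet S (∑ v, w v) D ι (fun x v => f v (fun i => x (p v i)) ()) := by
  induction D with
  | zero =>
    intro ι _ ιv _ p hp f hf
    choose A hA hfA using hf
    refine ⟨Matrix.of fun v => Function.extend (p v) (A v ()) 0, ?_, ?_⟩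
    · refine le_trans ?_ hS
      simp only [Matrix.of_apply, sum_sq_extend (hp _)]
      calc ∑ v, ∑ i, A v () i ^ 2 ≤ ∑ v : V, R ^ 2 :=
            Finset.sum_le_sum fun v _ => by simpa using hA v
        _ = _ := by simp
    · ext x v
      simp only [hfA, Matrix.mulVec, dotProduct, Matrix.of_apply, sum_extend_mul (hp _)]
  | succ D ih =>
    intro ι _ ιv _ p hp f hf
    choose ν hν A b g hc hA hg hfA using hf
    refine ⟨Σ v, ν v, inferInstance,
      Matrix.of fun i => Function.extend (p i.1) (A i.1 i.2) 0, fun i => b i.1 i.2,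
      fun x v => g v (fun i => x ⟨v, i⟩) (), ?_, ?_, ?_, ?_⟩
    · rw [Fintype.card_sigma]
      exact Finset.sum_le_sum fun v _ => hc v
    · simp only [Matrix.of_apply, sum_sq_extend (hp _), Fintype.sum_sigma]
      have h1 : ∑ v, (∑ i, ∑ j, A v i j ^ 2 + ∑ i, b v i ^ 2 + 1) ≤ ∑ v : V, R ^ 2 :=
        Finset.sum_le_sum fun v _ => hA v
      simp only [Finset.sum_add_distrib, Finset.sum_const, Finset.card_univ, nsmul_eq_mul,
        mul_one] at h1
      rcases isEmpty_or_nonempty V with hV | hV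
      -- With no networks at all, the single `+ 1` of the joint layer is not paid for by any block;
      -- `hS1` pays for it.
      · simp only [Finset.univ_eq_empty, Finset.sum_empty]
        simpa using hS1.trans (le_abs_self S)
      · have h2 : (1 : ℝ) ≤ Fintype.card V := by exact_mod_cast Fintype.card_pos
        linarith
    -- Only the first layer reads overlapping inputs; from here on each network reads its own
    -- summand of the sigma type.
    · exact ih (ι := Σ v, ν v) (p := fun v i => Sigma.mk v i) (fun v => sigma_mk_injective) hg
    · ext x v
      simp only [hfA, Matrix.mulVec, dotProduct, Matrix.of_apply, sum_extend_mul (hp _)]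

/-- By homogeneity of ReLU, a factor `l ^ (D + 1)` at the input can be spread over all layers. -/
theorem UnifNet.rescale {R l : ℝ} {w : ℕ} {κ : Type} [Fintype κ] (hl : 1 ≤ l) {D : ℕ} :
    ∀ {ι : Type} [Fintype ι] {f : (ι → ℝ) → κ → ℝ}, UnifNet R w D ι f →
      UnifNet (l * R) w D ι (fun x => f fun i => l ^ (D + 1) * x i) := by
  have hl0 : 0 < l := by linarith
  induction D with
  | zero =>
    rintro ι _ f ⟨A, hA, rfl⟩
    refine ⟨l • A, ?_, ?_⟩
    · simp only [Matrix.smul_apply, smul_eq_mul, mul_pow, ← Finset.mul_sum]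
      gcongr
    · ext x i
      simp only [Matrix.mulVec, dotProduct, Matrix.smul_apply, smul_eq_mul]
      exact Finset.sum_congr rfl fun j _ => by ring
  | succ D ih =>
    rintro ι _ f ⟨ν, _, A, b, g, hc, hA, hg, rfl⟩
    -- The first matrix takes one factor `l`; the other `l ^ (D + 1)` is pulled through ReLU into
    -- the remaining layers, so the bias must be divided by it.
    refine ⟨ν, _, l • A, fun i => b i / l ^ (D + 1), _, hc, ?_, ih hg, ?_⟩
    · simp only [Matrix.smul_apply, smul_eq_mul, mul_pow, ← Finset.mul_sum, div_pow,
        ← Finset.sum_div]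
      have h1 : (∑ i, b i ^ 2) / (l ^ (D + 1)) ^ 2 ≤ ∑ i, b i ^ 2 :=
        div_le_self (by positivity) (one_le_pow₀ (one_le_pow₀ hl))
      have h2 : 1 ≤ l ^ 2 := one_le_pow₀ hl
      have h3 : 0 ≤ ∑ i, b i ^ 2 := by positivity
      have h4 : l ^ 2 * (∑ i, ∑ j, A i j ^ 2 + ∑ i, b i ^ 2 + 1) ≤ l ^ 2 * R ^ 2 := by gcongr
      nlinarith
    · funext x
      refine congrArg g (funext fun i => ?_)
      have h1 : (∑ j, A i j * (l ^ (D + 1 + 1) * x j) + b i)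
          = l ^ (D + 1) * (∑ j, l * A i j * x j + b i / l ^ (D + 1)) := by
        rw [mul_add, mul_div_cancel₀ _ (by positivity), Finset.mul_sum]
        congr 1
        exact Finset.sum_congr rfl fun j _ => by ring
      simp only [Matrix.mulVec, dotProduct, Matrix.smul_apply, smul_eq_mul]
      rw [h1, mul_max_of_nonneg _ _ (by positivity), mul_zero]

/-- A linear functional as a network of any depth. -/
theorem unifNet_functional {R : ℝ} {w : ℕ} (hR : 3 ≤ R) (hw : 2 ≤ w) (D : ℕ) :
    ∀ {ι : Type} [Fintype ι] (a : ι → ℝ), ∑ i, a i ^ 2 ≤ 4 →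
      UnifNet R w D ι (fun x (_ : Unit) => ∑ i, a i * x i) := by
  induction D with
  | zero =>
    intro ι _ a ha
    refine ⟨Matrix.of fun _ => a, ?_, ?_⟩
    · simp only [Matrix.of_apply, Finset.univ_unique, Finset.sum_singleton]
      nlinarith
    · ext x i
      simp [Matrix.mulVec, dotProduct]
  | succ D ih =>
    intro ι _ a ha
    -- Here t = σ(t) - σ(-t). The layer has squared norm at most 2·4 + 1 = 9, whence `3 ≤ R`, and
    -- the vector (1,-1) meets the bound `4` again.
    refine ⟨Fin 2, inferInstance, Matrix.of fun i j => (![1, -1] i : ℝ) * a j, 0, _, by simpa using hw,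
      ?_, ih ![1, -1] (by norm_num [Fin.sum_univ_two]), ?_⟩
    · simp [Fin.sum_univ_two]
      nlinarith
    · ext x i
      simp [Fin.sum_univ_two, Matrix.mulVec, dotProduct]
      rcases le_total 0 (∑ i, a i * x i) with h | h
      · rw [max_eq_right h, max_eq_left (by linarith)]; simp
      · rw [max_eq_left h, max_eq_right (by linarith)]; simp

/-- Truncation to `[-1,1]`. -/
def clip (t : ℝ) : ℝ := max (-1) (min 1 t)

theorem clip_eq (t : ℝ) :
    clip t = max 0 t - max 0 (-t) - max 0 (t - 1) + max 0 (-t - 1) := by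
  unfold clip
  grind

theorem abs_clip_le (t : ℝ) : |clip t| ≤ 1 := by
  unfold clip
  grind

theorem abs_sub_clip_le {s : ℝ} (t : ℝ) (hs : |s| ≤ 1) : |s - clip t| ≤ |s - t| := by
  unfold clip
  grind

/-- By `clip_eq`, four neurons compute the truncation: four copies of `a`, two biases `-1` and the
`+ 1` give the hypothesis on `R`. The read-out (1,-1,-1,1) has square norm exactly 4, and the
remaining `D` layers merely transport it. -/
theorem unifNet_clip_functional {R : ℝ} {w : ℕ} (hR : 3 ≤ R) (hw : 4 ≤ w) (D : ℕ)
    {ι : Type} [Fintype ι] (a : ι → ℝ) (ha : 4 * ∑ i, a i ^ 2 + 3 ≤ R ^ 2) :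
    UnifNet R w (D + 1) ι (fun x (_ : Unit) => clip (∑ i, a i * x i)) := by
  refine ⟨Fin 4, inferInstance, Matrix.of fun i j => (![1, -1, 1, -1] i : ℝ) * a j,
    ![0, 0, -1, -1], _,
    by simpa using hw, ?_, unifNet_functional hR (by omega) D ![1, -1, -1, 1]
      (by simp [Fin.sum_univ_four]; norm_num), ?_⟩
  · simp [Fin.sum_univ_four]
    linarith
  · ext x i
    rw [clip_eq]
    simp [Fin.sum_univ_four, Matrix.mulVec, dotProduct]
    ring_nf

/-! ### Approximate squares, products and products over a binary tree -/

/-- The slope changes of the piecewise linear interpolation of `t ↦ t²` at the points `i / m`. -/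
noncomputable def sqCoeff (m i : ℕ) : ℝ := if i = 0 then 1 / m else 2 / m

/-- The piecewise linear interpolation of `t ↦ t²` on `[0,2]` at the points `i / m`. -/
noncomputable def sqApprox (m : ℕ) (t : ℝ) : ℝ := ∑ i : Fin (2 * m), sqCoeff m i * max 0 (t - (i : ℕ) / m)

theorem sqCoeff_nonneg (m i : ℕ) : 0 ≤ sqCoeff m i := by
  unfold sqCoeff
  split_ifs <;> positivity

theorem sqCoeff_le (m i : ℕ) : sqCoeff m i ≤ 2 / m := by
  unfold sqCoeff
  split_ifs
  · gcongr
    norm_num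
  · rfl

/-- The terms with knots up to `k / m` add up to the chord of t² over [k/m, (k+1)/m], in the form
that displays the interpolation error. -/
theorem sum_sqCoeff_mul (m k : ℕ) (t : ℝ) :
    ∑ i ∈ Finset.range (k + 1), sqCoeff m i * (t - i / m) =
      t ^ 2 + (t - k / m) * ((k + 1) / m - t) := by
  induction k with
  | zero => simp [sqCoeff]; ring
  | succ k ih =>
    rw [Finset.sum_range_succ, ih]
    simp only [sqCoeff, Nat.succ_ne_zero, if_false]
    push_cast
    ring

theorem exists_sqApprox_eq {m : ℕ} (hm : 0 < m) {t : ℝ} (h0 : 0 ≤ t) (h2 : t ≤ 2) :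
    ∃ k : ℕ, (k : ℝ) / m ≤ t ∧ t ≤ (k + 1) / m ∧
      sqApprox m t = t ^ 2 + (t - k / m) * ((k + 1) / m - t) := by
  have hm' : (0 : ℝ) < m := by exact_mod_cast hm
  obtain ⟨k, hk, h1, h3⟩ : ∃ k : ℕ, k < 2 * m ∧ (k : ℝ) / m ≤ t ∧ t ≤ (k + 1) / m := by
    rcases h2.lt_or_eq with h | h
    · refine ⟨⌊t * m⌋₊, ?_, ?_, ?_⟩
      · rw [Nat.floor_lt (by positivity)]
        push_cast
        gcongr
      · rw [div_le_iff₀ hm']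
        exact Nat.floor_le (by positivity)
      · rw [le_div_iff₀ hm']
        exact (Nat.lt_floor_add_one _).le
    -- At t = 2 the floor would be 2m, one past the last knot, so the right end of the last interval
    -- is used.
    · refine ⟨2 * m - 1, by omega, ?_, ?_⟩ <;> rw [Nat.cast_sub (by omega)] <;> push_cast
      · rw [div_le_iff₀ hm', h]
        linarith
      · rw [le_div_iff₀ hm', h]
        linarith
  refine ⟨k, h1, h3, ?_⟩
  rw [← sum_sqCoeff_mul, sqApprox,
    Fin.sum_univ_eq_sum_range (fun i => sqCoeff m i * max 0 (t - (i : ℕ) / m)) (2 * m)]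
  symm
  refine Finset.sum_subset_zero_on_sdiff (by simpa using hk) ?_ ?_
  · intro i hi
    simp only [Finset.mem_sdiff, Finset.mem_range, not_lt] at hi
    rw [max_eq_left, mul_zero]
    have : ((k : ℝ) + 1) / m ≤ i / m := by
      gcongr
      exact_mod_cast hi.2
    linarith
  · intro i hi
    rw [max_eq_right]
    have : (i : ℝ) / m ≤ k / m := by
      gcongr
      exact Nat.lt_succ_iff.1 (Finset.mem_range.1 hi)
    linarith

theorem sqApprox_error {m : ℕ} (hm : 0 < m) {t : ℝ} (h0 : 0 ≤ t) (h2 : t ≤ 2) :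
    |sqApprox m t - t ^ 2| ≤ 1 / (m : ℝ) ^ 2 := by
  have hm' : (0 : ℝ) < m := by exact_mod_cast hm
  obtain ⟨k, h1, h3, h4⟩ := exists_sqApprox_eq hm h0 h2
  rw [h4, add_sub_cancel_left, abs_of_nonneg (mul_nonneg (by linarith) (by linarith))]
  have h5 : t - k / m ≤ 1 / m := by
    rw [add_div] at h3
    linarith
  have h6 : (k + 1) / m - t ≤ 1 / m := by
    rw [add_div]
    linarith
  calc _ ≤ 1 / (m : ℝ) * (1 / m) := by
        apply mul_le_mul h5 h6 (by linarith) (by positivity)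
    _ = _ := by field_simp

theorem sqApprox_nonneg (m : ℕ) (t : ℝ) : 0 ≤ sqApprox m t :=
  Finset.sum_nonneg fun i _ => mul_nonneg (sqCoeff_nonneg m i) (le_max_left _ _)

theorem sqApprox_mono (m : ℕ) : Monotone (sqApprox m) := fun _ _ h =>
  Finset.sum_le_sum fun i _ => mul_le_mul_of_nonneg_left (max_le_max_left _ (by linarith))
    (sqCoeff_nonneg m i)

/-- Interpolation is exact at the node 2. With monotonicity this keeps `sqApprox` in [0,4] without
any error term, so `mulApprox` maps [-1,1]² into [-1,1] and gates can be stacked. -/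
theorem sqApprox_two {m : ℕ} (hm : 0 < m) : sqApprox m 2 = 4 := by
  have hm' : (0 : ℝ) < m := by exact_mod_cast hm
  obtain ⟨k, h1, h3, h4⟩ := exists_sqApprox_eq hm (t := 2) (by norm_num) le_rfl
  have h5 : (2 - (k : ℝ) / m) * ((k + 1) / m - 2) = 0 := by
    have h6 : k ≤ 2 * m := by
      rw [div_le_iff₀ hm'] at h1
      exact_mod_cast h1
    have h7 : 2 * m ≤ k + 1 := by
      rw [le_div_iff₀ hm'] at h3
      exact_mod_cast h3
    rcases h6.eq_or_lt with h | h
    · rw [h]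
      push_cast
      field_simp
      ring
    · have : k + 1 = 2 * m := by omega
      have : (k : ℝ) + 1 = 2 * m := by exact_mod_cast this
      rw [this]
      field_simp
      ring
  rw [h4, h5]
  norm_num

theorem sqApprox_le {m : ℕ} (hm : 0 < m) {t : ℝ} (h2 : t ≤ 2) : sqApprox m t ≤ 4 :=
  sqApprox_two hm ▸ sqApprox_mono m h2

theorem sqApprox_abs (m : ℕ) (t : ℝ) : sqApprox m |t| =
    ∑ i : Fin (2 * m), sqCoeff m i * (max 0 (t - (i : ℕ) / m) + max 0 (-t - (i : ℕ) / m)) := by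
  refine Finset.sum_congr rfl fun i _ => ?_
  have : (0 : ℝ) ≤ (i : ℕ) / m := by positivity
  congr 1
  rcases le_total 0 t with h | h
  · rw [abs_of_nonneg h, max_eq_left (b := -t - (i : ℕ) / m) (by linarith), add_zero]
  · rw [abs_of_nonpos h, max_eq_left (b := t - (i : ℕ) / m) (by linarith), zero_add]

/-- The approximate product obtained from `sqApprox` by polarization. -/
noncomputable def mulApprox (m : ℕ) (a b : ℝ) : ℝ := (sqApprox m |a + b| - sqApprox m |a - b|) / 4

theorem mulApprox_zero_left (m : ℕ) (b : ℝ) : mulApprox m 0 b = 0 := by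
  simp [mulApprox]

theorem mulApprox_zero_right (m : ℕ) (a : ℝ) : mulApprox m a 0 = 0 := by
  simp [mulApprox]

theorem abs_mulApprox_le {m : ℕ} (hm : 0 < m) {a b : ℝ} (ha : |a| ≤ 1) (hb : |b| ≤ 1) :
    |mulApprox m a b| ≤ 1 := by
  have h1 : |a + b| ≤ 2 := (abs_add_le a b).trans (by linarith)
  have h2 : |a - b| ≤ 2 := (abs_sub a b).trans (by linarith)
  have h3 := sqApprox_le hm h1
  have h4 := sqApprox_le hm h2
  have h5 := sqApprox_nonneg m |a + b|
  have h6 := sqApprox_nonneg m |a - b|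
  rw [mulApprox, abs_le]
  constructor <;> linarith

theorem mulApprox_error {m : ℕ} (hm : 0 < m) {a b : ℝ} (ha : |a| ≤ 1) (hb : |b| ≤ 1) :
    |mulApprox m a b - a * b| ≤ 1 / (m : ℝ) ^ 2 := by
  have h1 : |a + b| ≤ 2 := (abs_add_le a b).trans (by linarith)
  have h2 : |a - b| ≤ 2 := (abs_sub a b).trans (by linarith)
  have h3 := sqApprox_error hm (abs_nonneg _) h1
  have h4 := sqApprox_error hm (abs_nonneg _) h2
  have h5 : (0 : ℝ) ≤ 1 / (m : ℝ) ^ 2 := by positivity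
  rw [sq_abs, abs_le] at h3 h4
  rw [mulApprox, abs_le]
  constructor <;> nlinarith

/-- A product over a binary tree, for an arbitrary binary operation. -/
def treeProd (mul : ℝ → ℝ → ℝ) : (q : ℕ) → ((Fin q → Bool) → ℝ) → ℝ
  | 0, z => z Fin.elim0
  | q + 1, z => treeProd mul q fun k => mul (z (Fin.cons false k)) (z (Fin.cons true k))

theorem abs_prod_sub_prod_le {ι : Type*} (s : Finset ι) {x y : ι → ℝ} {δ : ℝ}
    (hx : ∀ i ∈ s, |x i| ≤ 1) (hy : ∀ i ∈ s, |y i| ≤ 1) (h : ∀ i ∈ s, |x i - y i| ≤ δ) :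
    |∏ i ∈ s, x i - ∏ i ∈ s, y i| ≤ s.card * δ := by
  classical
  induction s using Finset.induction_on with
  | empty => simp
  | insert a s ha ih =>
    rw [Finset.prod_insert ha, Finset.prod_insert ha, Finset.card_insert_of_notMem ha]
    have h1 := ih (fun i hi => hx i (Finset.mem_insert_of_mem hi))
      (fun i hi => hy i (Finset.mem_insert_of_mem hi))
      (fun i hi => h i (Finset.mem_insert_of_mem hi))
    have h2 : |∏ i ∈ s, y i| ≤ 1 := by
      rw [Finset.abs_prod]
      exact Finset.prod_le_one (fun _ _ => abs_nonneg _)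
        fun i hi => hy i (Finset.mem_insert_of_mem hi)
    have h3 := hx a (Finset.mem_insert_self _ _)
    have h4 := h a (Finset.mem_insert_self _ _)
    have h5 : x a * ∏ i ∈ s, x i - y a * ∏ i ∈ s, y i =
      x a * (∏ i ∈ s, x i - ∏ i ∈ s, y i) + (x a - y a) * ∏ i ∈ s, y i := by ring
    rw [h5]
    refine (abs_add_le _ _).trans ?_
    rw [abs_mul, abs_mul]
    push_cast
    nlinarith [abs_nonneg (x a), abs_nonneg (x a - y a), abs_nonneg (∏ i ∈ s, y i),
      abs_nonneg (∏ i ∈ s, x i - ∏ i ∈ s, y i)]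

theorem prod_bool_fun_succ {q : ℕ} (z : (Fin (q + 1) → Bool) → ℝ) :
    ∏ k, z k = ∏ k : Fin q → Bool, z (Fin.cons false k) * z (Fin.cons true k) := by
  rw [← (Fin.consEquiv fun _ => Bool).prod_comp, Fintype.prod_prod_type, Finset.prod_comm]
  refine Finset.prod_congr rfl fun k _ => ?_
  rw [Fintype.prod_bool, mul_comm]
  rfl

/-- The `2 ^ q` gates nearest the leaves err by at most 1/m² each, and a product of numbers in
[-1,1] is 1-Lipschitz in each factor; the rest of the tree is again bounded by 2^q/m². -/
theorem abs_treeProd_sub_le {m : ℕ} (hm : 0 < m) (q : ℕ) :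
    ∀ z : (Fin q → Bool) → ℝ, (∀ k, |z k| ≤ 1) →
      |treeProd (mulApprox m) q z - ∏ k, z k| ≤ 2 ^ q / (m : ℝ) ^ 2 := by
  induction q with
  | zero =>
    intro z _
    have h : treeProd (mulApprox m) 0 z = ∏ k, z k := by
      rw [Fintype.prod_unique]
      exact congrArg z (Subsingleton.elim _ _)
    rw [h, sub_self, abs_zero]
    positivity
  | succ q ih =>
    intro z hz
    have h1 := ih (fun k => mulApprox m (z (Fin.cons false k)) (z (Fin.cons true k)))
      fun k => abs_mulApprox_le hm (hz _) (hz _)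
    have h2 := abs_prod_sub_prod_le (Finset.univ : Finset (Fin q → Bool))
      (x := fun k => mulApprox m (z (Fin.cons false k)) (z (Fin.cons true k)))
      (y := fun k => z (Fin.cons false k) * z (Fin.cons true k)) (δ := 1 / (m : ℝ) ^ 2)
      (fun k _ => abs_mulApprox_le hm (hz _) (hz _))
      (fun k _ => by rw [abs_mul]; exact mul_le_one₀ (hz _) (abs_nonneg _) (hz _))
      (fun k _ => mulApprox_error hm (hz _) (hz _))
    rw [← prod_bool_fun_succ] at h2
    simp only [Finset.card_univ, Fintype.card_fun, Fintype.card_bool, Fintype.card_fin,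
      Nat.cast_pow, Nat.cast_ofNat] at h2
    rw [treeProd, pow_succ]
    refine (abs_sub_le _ _ _).trans ((add_le_add h1 h2).trans (le_of_eq ?_))
    ring

/-- Polarization gives exactly 0 when one argument is 0, and the zero moves up the tree. Hence a
term vanishes exactly outside the support of its hats, even after approximation. -/
theorem treeProd_eq_zero {m : ℕ} (q : ℕ) :
    ∀ (z : (Fin q → Bool) → ℝ) (k : Fin q → Bool), z k = 0 → treeProd (mulApprox m) q z = 0 := by
  induction q with
  | zero =>
    intro z k hk
    rw [treeProd, ← hk, Subsingleton.elim k Fin.elim0]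
  | succ q ih =>
    intro z k hk
    refine ih _ (Fin.tail k) ?_
    rw [← Fin.cons_self_tail k] at hk
    cases h : k 0
    · rw [h] at hk
      rw [hk, mulApprox_zero_left]
    · rw [h] at hk
      rw [hk, mulApprox_zero_right]

/-! ### The network for a sum of approximate products -/

/-- `F` composed with any read-out of its arguments from disjoint groups of neurons, with
coefficient vectors of square norm at most `6`, is a network. -/
def ReadoutNet (R : ℝ) (w D : ℕ) {I : Type} [Fintype I] (F : (I → ℝ) → ℝ) : Prop :=
  ∀ (H : Type) [Fintype H] (c : I → H → ℝ), (∀ i, ∑ h, c i h ^ 2 ≤ 6) →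
    UnifNet R w D (I × H) (fun y (_ : Unit) => F fun i => ∑ h, c i h * y (i, h))

/-- The sign `-1` or `1`. -/
def boolSign (t : Bool) : ℝ := if t then -1 else 1

theorem boolSign_sq (t : Bool) : boolSign t ^ 2 = 1 := by
  cases t <;> simp [boolSign]

theorem mulApprox_eq_sum (m : ℕ) (u v : ℝ) : mulApprox m u v =
    ∑ p : Bool × Bool × Fin (2 * m), boolSign p.1 * sqCoeff m p.2.2 / 4 *
      max 0 (boolSign p.2.1 * (u + boolSign p.1 * v) - (p.2.2 : ℕ) / m) := by
  simp only [Fintype.sum_prod_type, Fintype.sum_bool, mulApprox, sqApprox_abs, boolSign]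
  simp only [← Finset.sum_add_distrib, ← Finset.sum_sub_distrib, Finset.sum_div]
  refine Finset.sum_congr rfl fun i _ => ?_
  simp only [if_true, Bool.false_eq_true, if_false]
  ring_nf

theorem sum_tail_eq {J : Type} [Fintype J] [DecidableEq J] {q : ℕ}
    (φ : J × (Fin (q + 1) → Bool) → ℝ) (i : J × (Fin q → Bool)) :
    ∑ k, (if (k.1, Fin.tail k.2) = i then φ k else 0) =
      φ (i.1, Fin.cons false i.2) + φ (i.1, Fin.cons true i.2) := by
  rw [Fintype.sum_prod_type]
  have h : ∀ j : J, ∑ k : Fin (q + 1) → Bool, (if (j, Fin.tail k) = i then φ (j, k) else 0) =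
      if j = i.1 then φ (j, Fin.cons false i.2) + φ (j, Fin.cons true i.2) else 0 := by
    intro j
    rw [← (Fin.consEquiv fun _ => Bool).sum_comp, Fintype.sum_prod_type, Fintype.sum_bool]
    have e : ∀ b (k : Fin q → Bool),
        (Fin.consEquiv fun _ : Fin (q + 1) => Bool) (b, k) = Fin.cons b k := fun _ _ => rfl
    simp only [e, Fin.tail_cons, Prod.ext_iff]
    by_cases hj : j = i.1
    · simp [hj, add_comm]
    · simp [hj]
  simp [h]

/-- A layer of gates is prepended, with the read-out `c` of the arguments merged into its matrix.
Each gate uses 8m neurons; weights into them are scaled by μ = 1/√m and those out of them by 1/μ, so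
that neither square norm depends on `m`. Matrix, bias and the extra `1` are bounded by the constants
48, 16 and 1, within the allowance 80 and 1. -/
theorem ReadoutNet.mul {J : Type} [Fintype J] {R : ℝ} {w D m q : ℕ} (hm : 0 < m)
    (hR : 80 * (2 ^ (q + 1) * (Fintype.card J : ℝ)) + 1 ≤ R ^ 2)
    (hw : 8 * m * (2 ^ (q + 1) * Fintype.card J) ≤ w) {F : (J × (Fin q → Bool) → ℝ) → ℝ}
    (hF : ReadoutNet R w D F) :
    ReadoutNet R w (D + 1) (fun z : J × (Fin (q + 1) → Bool) → ℝ =>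
      F fun i => mulApprox m (z (i.1, Fin.cons false i.2)) (z (i.1, Fin.cons true i.2))) := by
  classical
  intro H _ c hc
  have hm' : (0 : ℝ) < m := by exact_mod_cast hm
  set μ : ℝ := 1 / √m with hμ
  have hμ0 : 0 < μ := by positivity
  have hμ2 : μ ^ 2 = 1 / m := by
    rw [hμ, div_pow, Real.sq_sqrt hm'.le, one_pow]
  let A : Matrix ((J × (Fin q → Bool)) × (Bool × Bool × Fin (2 * m)))
      ((J × (Fin (q + 1) → Bool)) × H) ℝ := Matrix.of fun n k =>
    if (k.1.1, Fin.tail k.1.2) = n.1 then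
      μ * boolSign n.2.2.1 * (if k.1.2 0 then boolSign n.2.1 else 1) * c k.1 k.2 else 0
  let b : (J × (Fin q → Bool)) × (Bool × Bool × Fin (2 * m)) → ℝ := fun n =>
    -(μ * ((n.2.2.2 : ℕ) / m))
  -- An argument feeds only the gate of its parent in the tree, that is 8m neurons, each with
  -- squared weight `c k h ^ 2 / m`.
  have hA : ∑ n, ∑ k, A n k ^ 2 = 8 * ∑ k, ∑ h, c k h ^ 2 := by
    rw [Finset.sum_comm, Fintype.sum_prod_type, Finset.mul_sum]
    refine Finset.sum_congr rfl fun k _ => ?_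
    rw [Finset.mul_sum]
    refine Finset.sum_congr rfl fun h _ => ?_
    rw [Fintype.sum_prod_type]
    have h1 : ∀ (i : J × (Fin q → Bool)) (p : Bool × Bool × Fin (2 * m)),
        A (i, p) (k, h) ^ 2 = if (k.1, Fin.tail k.2) = i then 1 / m * c k h ^ 2 else 0 := by
      intro i p
      simp only [A, Matrix.of_apply]
      split_ifs <;> simp [mul_pow, hμ2, boolSign_sq]
    simp only [h1, Finset.sum_const, Finset.card_univ, Fintype.card_prod, Fintype.card_bool,
      Fintype.card_fin, nsmul_eq_mul, mul_ite, mul_zero, Finset.sum_ite_eq, Finset.mem_univ,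
      if_true]
    push_cast
    field_simp
    ring
  have hA' : ∑ n, ∑ k, A n k ^ 2 ≤ 48 * (2 ^ (q + 1) * (Fintype.card J : ℝ)) := by
    rw [hA]
    have : ∑ k, ∑ h, c k h ^ 2 ≤ ∑ k : J × (Fin (q + 1) → Bool), (6 : ℝ) :=
      Finset.sum_le_sum fun k _ => hc k
    simp only [Finset.sum_const, Finset.card_univ, Fintype.card_prod, Fintype.card_fun,
      Fintype.card_bool, Fintype.card_fin, nsmul_eq_mul] at this
    push_cast at this
    linarith
  have hb : ∑ n, b n ^ 2 ≤ 16 * (2 ^ (q + 1) * (Fintype.card J : ℝ)) := by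
    have h1 : ∀ n, b n ^ 2 ≤ 4 / m := by
      intro n
      have h2 : ((n.2.2.2 : ℕ) : ℝ) / m ≤ 2 := by
        rw [div_le_iff₀ hm']
        exact_mod_cast n.2.2.2.2.le
      have h3 : (0 : ℝ) ≤ ((n.2.2.2 : ℕ) : ℝ) / m := by positivity
      simp only [b, neg_sq, mul_pow, hμ2]
      rw [div_mul_eq_mul_div, one_mul]
      gcongr
      nlinarith
    refine (Finset.sum_le_sum fun n _ => h1 n).trans (le_of_eq ?_)
    simp only [Finset.sum_const, Finset.card_univ, Fintype.card_prod, Fintype.card_fun,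
      Fintype.card_bool, Fintype.card_fin, nsmul_eq_mul]
    push_cast
    field_simp
    ring
  refine ⟨_, inferInstance, A, b, _, ?_, ?_, hF (Bool × Bool × Fin (2 * m))
    (fun _ p => boolSign p.1 * sqCoeff m p.2.2 / (4 * μ)) ?_, ?_⟩
  · refine le_trans ?_ hw
    simp only [Fintype.card_prod, Fintype.card_fun, Fintype.card_bool, Fintype.card_fin, pow_succ]
    nlinarith [Nat.zero_le (m * (2 ^ q * Fintype.card J))]
  · nlinarith [show (0 : ℝ) ≤ 2 ^ (q + 1) * (Fintype.card J : ℝ) by positivity]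
  · intro _
    -- Summed over 8m neurons this gives 2, within the bound 6 required of a read-out; the 6 itself
    -- is the square norm of the hat coefficients (1,-2,1).
    have h1 : ∀ p : Bool × Bool × Fin (2 * m),
        (boolSign p.1 * sqCoeff m p.2.2 / (4 * μ)) ^ 2 ≤ 1 / (4 * m) := by
      intro p
      have h2 : sqCoeff m p.2.2 ^ 2 ≤ (2 / m) ^ 2 :=
        pow_le_pow_left₀ (sqCoeff_nonneg _ _) (sqCoeff_le _ _) 2
      rw [div_pow, mul_pow, mul_pow, hμ2, boolSign_sq, one_mul]
      calc sqCoeff m p.2.2 ^ 2 / (4 ^ 2 * (1 / m)) ≤ (2 / m) ^ 2 / (4 ^ 2 * (1 / m)) := by gcongr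
        _ = _ := by
          field_simp
          norm_num
    refine (Finset.sum_le_sum fun p _ => h1 p).trans ?_
    simp only [Finset.sum_const, Finset.card_univ, Fintype.card_prod, Fintype.card_bool,
      Fintype.card_fin, nsmul_eq_mul]
    push_cast
    field_simp
    norm_num
  · funext y _
    refine congrArg F (funext fun i => ?_)
    rw [mulApprox_eq_sum]
    refine Finset.sum_congr rfl fun p _ => ?_
    have h1 : A.mulVec y (i, p) = μ * (boolSign p.2.1 *
        (∑ h, c (i.1, Fin.cons false i.2) h * y ((i.1, Fin.cons false i.2), h) +
          boolSign p.1 * ∑ h, c (i.1, Fin.cons true i.2) h * y ((i.1, Fin.cons true i.2), h))) := by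
      simp only [Matrix.mulVec, dotProduct, A, Matrix.of_apply, ite_mul, zero_mul]
      rw [Fintype.sum_prod_type]
      simp only [Finset.sum_ite_irrel, Finset.sum_const_zero]
      rw [sum_tail_eq (fun k => ∑ h, μ * boolSign p.2.1 * (if k.2 0 then boolSign p.1 else 1) *
        c k h * y (k, h))]
      simp only [Fin.cons_zero, if_true, Bool.false_eq_true, if_false, mul_one, Finset.mul_sum,
        mul_add]
      congr 1 <;> exact Finset.sum_congr rfl fun _ _ => by ring
    beta_reduce
    rw [h1]
    simp only [b]
    rw [← sub_eq_add_neg, ← mul_sub, ← mul_zero μ, ← mul_max_of_nonneg _ _ hμ0.le, mul_zero]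
    field_simp

/-- The root of the trees: 24 is four clip neurons times the bound 6 on the read-outs. -/
theorem readoutNet_zero {J : Type} [Fintype J] {R : ℝ} {w : ℕ} (hR : 3 ≤ R) (hw : 4 ≤ w) (D : ℕ)
    (a : J → ℝ) (ha : 24 * ∑ j, a j ^ 2 + 3 ≤ R ^ 2) :
    ReadoutNet R w (D + 1) (fun z : J × (Fin 0 → Bool) → ℝ =>
      clip (∑ j, a j * z (j, Fin.elim0))) := by
  intro H _ c hc
  have h := unifNet_clip_functional hR hw D
    (fun i : (J × (Fin 0 → Bool)) × H => a i.1.1 * c i.1 i.2) (by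
      refine le_trans ?_ ha
      rw [Fintype.sum_prod_type]
      have : ∑ i : J × (Fin 0 → Bool), ∑ h, (a i.1 * c i h) ^ 2 ≤
          ∑ i : J × (Fin 0 → Bool), 6 * a i.1 ^ 2 := by
        refine Finset.sum_le_sum fun i _ => ?_
        simp only [mul_pow, ← Finset.mul_sum]
        nlinarith [hc i, sq_nonneg (a i.1)]
      have e : ∑ i : J × (Fin 0 → Bool), a i.1 ^ 2 = ∑ j, a j ^ 2 := by
        rw [Fintype.sum_prod_type]
        simp
      rw [← Finset.mul_sum, e] at this
      linarith)
  convert h using 4 with y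
  rw [Fintype.sum_prod_type, Fintype.sum_prod_type]
  refine Finset.sum_congr rfl fun j _ => ?_
  rw [Fintype.sum_unique, Finset.mul_sum]
  refine Finset.sum_congr rfl fun h _ => ?_
  rw [mul_assoc]
  congr 3

theorem readoutNet_treeProd {J : Type} [Fintype J] {R : ℝ} {w m : ℕ} (hm : 0 < m) (hR : 3 ≤ R)
    (hw : 4 ≤ w) (D : ℕ) (a : J → ℝ) (ha : 24 * ∑ j, a j ^ 2 + 3 ≤ R ^ 2) (q : ℕ)
    (hRq : 80 * (2 ^ q * (Fintype.card J : ℝ)) + 1 ≤ R ^ 2)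
    (hwq : 8 * m * (2 ^ q * Fintype.card J) ≤ w) :
    ReadoutNet R w (D + 1 + q) (fun z : J × (Fin q → Bool) → ℝ =>
      clip (∑ j, a j * treeProd (mulApprox m) q fun k => z (j, k))) := by
  induction q with
  | zero => exact readoutNet_zero hR hw D a ha
  | succ q ih =>
    refine ReadoutNet.mul hm hRq hwq (ih (le_trans ?_ hRq) (le_trans ?_ hwq))
    · gcongr <;> norm_num
    · gcongr <;> norm_num

/-- The network for `clip (∑ a_j ∏~ z_{j,k})` where each `z_{j,k}` is a combination of three ridge
functions `σ (l ^ (D + q + 3) * (a · x + b))`. -/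
theorem unifNet_ridge {J : Type} [Fintype J] {R l : ℝ} {w m d : ℕ} (hm : 0 < m) (hR : 3 ≤ R)
    (hl : 1 ≤ l) (hw : 4 ≤ w) (D : ℕ) (a : J → ℝ) (ha : 24 * ∑ j, a j ^ 2 + 3 ≤ R ^ 2) (q : ℕ)
    (hRq : 80 * (2 ^ q * (Fintype.card J : ℝ)) + 1 ≤ R ^ 2)
    (hwq : 8 * m * (2 ^ q * Fintype.card J) ≤ w)
    (c : J × (Fin q → Bool) → Fin 3 → ℝ) (hc : ∀ i, ∑ h, c i h ^ 2 ≤ 6)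
    (s : J × (Fin q → Bool) → Fin 3 → Fin d → ℝ) (hs : ∀ i h, ∑ t, s i h t ^ 2 ≤ 1)
    (b : J × (Fin q → Bool) → Fin 3 → ℝ) (hb : ∀ i h, |b i h| ≤ 2) :
    UnifNet (l * R) w (D + 1 + q + 1) (Fin d) (fun x (_ : Unit) =>
      clip (∑ j, a j * treeProd (mulApprox m) q fun k =>
        ∑ h, c (j, k) h * max 0 (l ^ (D + 1 + q + 2) * (∑ t, s (j, k) h t * x t + b (j, k) h)))) := by
  -- The part after the ridge layer has `D + 1 + q + 1` matrices and absorbs that many factors `l`;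
  -- the ridge layer carries one more, which makes up the exponent `D + 1 + q + 2`.
  have hn := (readoutNet_treeProd hm hR hw D a ha q hRq hwq (Fin 3) c hc).rescale hl
  refine ⟨(J × (Fin q → Bool)) × Fin 3, inferInstance, Matrix.of fun n t => l * s n.1 n.2 t,
    fun n => l * b n.1 n.2, _, ?_, ?_, hn, ?_⟩
  · refine le_trans ?_ hwq
    simp only [Fintype.card_prod, Fintype.card_fun, Fintype.card_bool, Fintype.card_fin]
    nlinarith [Nat.zero_le (2 ^ q * Fintype.card J)]
  · have h1 : ∑ n : (J × (Fin q → Bool)) × Fin 3, ∑ t, (l * s n.1 n.2 t) ^ 2 ≤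
        ∑ n : (J × (Fin q → Bool)) × Fin 3, l ^ 2 := by
      refine Finset.sum_le_sum fun n _ => ?_
      simp only [mul_pow, ← Finset.mul_sum]
      nlinarith [hs n.1 n.2, sq_nonneg l]
    have h2 : ∑ n : (J × (Fin q → Bool)) × Fin 3, (l * b n.1 n.2) ^ 2 ≤
        ∑ n : (J × (Fin q → Bool)) × Fin 3, 4 * l ^ 2 := by
      refine Finset.sum_le_sum fun n _ => ?_
      have : b n.1 n.2 ^ 2 ≤ 2 ^ 2 := by
        rw [← sq_abs]
        exact pow_le_pow_left₀ (abs_nonneg _) (hb _ _) 2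
      rw [mul_pow]
      nlinarith [sq_nonneg l]
    simp only [Finset.sum_const, Finset.card_univ, Fintype.card_prod, Fintype.card_fun,
      Fintype.card_bool, Fintype.card_fin, nsmul_eq_mul] at h1 h2
    push_cast at h1 h2
    simp only [Matrix.of_apply]
    have h3 : l ^ 2 * (80 * (2 ^ q * (Fintype.card J : ℝ)) + 1) ≤ l ^ 2 * R ^ 2 := by gcongr
    have h4 : 0 ≤ l ^ 2 * (2 ^ q * (Fintype.card J : ℝ)) := by positivity
    have h5 : 1 ≤ l ^ 2 := one_le_pow₀ hl
    rw [mul_pow]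
    nlinarith
  · funext x _
    refine congrArg clip (Finset.sum_congr rfl fun j _ => ?_)
    congr 2
    funext k
    refine Finset.sum_congr rfl fun h _ => ?_
    congr 1
    have h1 : l ^ (D + 1 + q + 2) * (∑ t, s (j, k) h t * x t + b (j, k) h) = l ^ (D + 1 + q + 1) *
        ((Matrix.of fun (n : (J × (Fin q → Bool)) × Fin 3) t => l * s n.1 n.2 t).mulVec x ((j, k), h)
          + l * b (j, k) h) := by
      simp only [Matrix.mulVec, dotProduct, Matrix.of_apply, mul_assoc l, ← Finset.mul_sum]
      ring
    beta_reduce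
    rw [h1, mul_max_of_nonneg _ _ (by positivity), mul_zero]

/-! ### Taylor approximation on the cube -/

theorem cube_eq_closedBall (n : ℕ) : cube n = Metric.closedBall 0 1 := by
  ext x
  rw [mem_closedBall_zero_iff, pi_norm_le_iff_of_nonneg zero_le_one]
  simp only [cube, Set.mem_Icc, Pi.le_def, Real.norm_eq_abs, abs_le, forall_and]

theorem mem_cube_iff {n : ℕ} {x : Fin n → ℝ} : x ∈ cube n ↔ ∀ i, |x i| ≤ 1 := by
  rw [cube_eq_closedBall, mem_closedBall_zero_iff, pi_norm_le_iff_of_nonneg zero_le_one]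
  rfl

theorem convex_cube (n : ℕ) : Convex ℝ (cube n) := by
  rw [cube_eq_closedBall]
  exact convex_closedBall 0 1

theorem cube_subset_closure_interior (n : ℕ) : cube n ⊆ closure (interior (cube n)) := by
  rw [cube_eq_closedBall, interior_closedBall _ one_ne_zero, closure_ball _ one_ne_zero]

theorem uniqueDiffOn_cube (n : ℕ) : UniqueDiffOn ℝ (cube n) := by
  refine uniqueDiffOn_convex (convex_cube n) ?_
  rw [cube_eq_closedBall, interior_closedBall _ one_ne_zero]
  exact ⟨0, by simp⟩

section

open Set

variable {n : ℕ}

/-! ### Iterated partial derivatives on the closed cube and their commutation. -/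

theorem cubePartial_congr {u v : (Fin n → ℝ) → ℝ} (i : Fin n) (h : EqOn u v (cube n)) :
    EqOn (cubePartial i u) (cubePartial i v) (cube n) := fun x hx => by
  simp only [cubePartial, fderivWithin_congr' h hx]

theorem cubePartial_iterate_congr {u v : (Fin n → ℝ) → ℝ} (i : Fin n) (h : EqOn u v (cube n))
    (k : ℕ) : EqOn ((cubePartial i)^[k] u) ((cubePartial i)^[k] v) (cube n) := by
  induction k with
  | zero => exact h
  | succ k ih =>
    rw [Function.iterate_succ_apply', Function.iterate_succ_apply']
    exact cubePartial_congr i ih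

theorem ContDiffOn.cubePartial {k : ℕ} {u : (Fin n → ℝ) → ℝ}
    (hu : ContDiffOn ℝ ((k + 1 : ℕ) : WithTop ℕ∞) u (cube n)) (i : Fin n) :
    ContDiffOn ℝ (k : WithTop ℕ∞) (cubePartial i u) (cube n) :=
  (hu.fderivWithin (uniqueDiffOn_cube n) (by push_cast; rfl)).clm_apply contDiffOn_const

theorem ContDiffOn.cubePartial_iterate {k j : ℕ} {u : (Fin n → ℝ) → ℝ}
    (hu : ContDiffOn ℝ ((k + j : ℕ) : WithTop ℕ∞) u (cube n)) (i : Fin n) :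
    ContDiffOn ℝ (k : WithTop ℕ∞) ((_root_.cubePartial i)^[j] u) (cube n) := by
  induction j generalizing k with
  | zero => exact hu
  | succ j ih =>
    rw [Function.iterate_succ_apply']
    refine ContDiffOn.cubePartial (ih ?_) i
    rwa [add_right_comm]

/-- Symmetry of the second derivative within a set also holds at boundary points, because the cube
lies in the closure of its interior. -/
theorem cubePartial_comm {u : (Fin n → ℝ) → ℝ}
    (hu : ContDiffOn ℝ ((2 : ℕ) : WithTop ℕ∞) u (cube n)) (i j : Fin n) :
    EqOn (cubePartial i (cubePartial j u)) (cubePartial j (cubePartial i u)) (cube n) := by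
  intro x hx
  have hd : DifferentiableWithinAt ℝ (fderivWithin ℝ u (cube n)) (cube n) x :=
    ((hu.fderivWithin (m := 1) (uniqueDiffOn_cube n) (by norm_num)).differentiableOn
      (by norm_num)) x hx
  have key : ∀ a b : Fin n, cubePartial a (cubePartial b u) x =
      fderivWithin ℝ (fderivWithin ℝ u (cube n)) (cube n) x (Pi.single a 1) (Pi.single b 1) := by
    intro a b
    have h1 : HasFDerivWithinAt (cubePartial b u) _ (cube n) x :=
      hd.hasFDerivWithinAt.clm_apply (hasFDerivWithinAt_const (Pi.single b 1 : Fin n → ℝ) x (cube n))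
    rw [cubePartial, h1.fderivWithin ((uniqueDiffOn_cube n) x hx)]
    simp
  have hs : IsSymmSndFDerivWithinAt ℝ u (cube n) x :=
    (hu x hx).isSymmSndFDerivWithinAt (by simp) (uniqueDiffOn_cube n)
      (cube_subset_closure_interior n hx) hx
  rw [key, key]
  exact hs _ _

theorem cubePartial_iterate_comm {u : (Fin n → ℝ) → ℝ} {k : ℕ}
    (hu : ContDiffOn ℝ ((k + 1 : ℕ) : WithTop ℕ∞) u (cube n)) (i j : Fin n) :
    EqOn (cubePartial i ((cubePartial j)^[k] u)) ((cubePartial j)^[k] (cubePartial i u))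
      (cube n) := by
  induction k with
  | zero => exact fun _ _ => rfl
  | succ k ih =>
    rw [Function.iterate_succ_apply', Function.iterate_succ_apply']
    refine (cubePartial_comm (ContDiffOn.cubePartial_iterate (k := 2) (j := k) ?_ j) i j).trans
      (cubePartial_congr j (ih ?_))
    · convert hu using 2
      ring
    · exact hu.of_le (by exact_mod_cast Nat.le_succ _)

theorem contDiffOn_foldr_cubePartial {u : (Fin n → ℝ) → ℝ} (γ : Fin n → ℕ) (l : List (Fin n))
    {k : ℕ} (hu : ContDiffOn ℝ ((k + (l.map γ).sum : ℕ) : WithTop ℕ∞) u (cube n)) :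
    ContDiffOn ℝ (k : WithTop ℕ∞) (l.foldr (fun i v => (cubePartial i)^[γ i] v) u) (cube n) := by
  induction l generalizing k with
  | nil => simpa using hu
  | cons a l ih =>
    refine ContDiffOn.cubePartial_iterate (ih ?_) a
    convert hu using 2
    simp [add_assoc]

/-- The new derivative commutes past those in the other variables until it reaches its own place in
the fixed order. -/
theorem cubePartial_foldr {u : (Fin n → ℝ) → ℝ} (γ : Fin n → ℕ) (i : Fin n) (l : List (Fin n))
    (hl : l.Nodup) (hi : i ∈ l)
    (hu : ContDiffOn ℝ ((1 + (l.map γ).sum : ℕ) : WithTop ℕ∞) u (cube n)) :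
    EqOn (cubePartial i (l.foldr (fun j v => (cubePartial j)^[γ j] v) u))
      (l.foldr (fun j v => (cubePartial j)^[(γ + Pi.single i 1 : Fin n → ℕ) j] v) u) (cube n) := by
  induction l with
  | nil => simp at hi
  | cons a l ih =>
    rw [List.nodup_cons] at hl
    simp only [List.foldr_cons]
    by_cases ha : a = i
    · subst ha
      have h1 : l.foldr (fun j v => (cubePartial j)^[(γ + Pi.single a 1 : Fin n → ℕ) j] v) u =
          l.foldr (fun j v => (cubePartial j)^[γ j] v) u := by
        refine List.foldr_ext _ _ _ fun j hj v => ?_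
        rw [Pi.add_apply, Pi.single_eq_of_ne (by rintro rfl; exact hl.1 hj), add_zero]
      rw [h1, Pi.add_apply, Pi.single_eq_same, Function.iterate_succ_apply']
      exact fun _ _ => rfl
    · have hil : i ∈ l := by
        rcases List.mem_cons.1 hi with h | h
        · exact absurd h.symm ha
        · exact h
      have h2 : ContDiffOn ℝ ((γ a + 1 : ℕ) : WithTop ℕ∞)
          (l.foldr (fun j v => (cubePartial j)^[γ j] v) u) (cube n) := by
        refine contDiffOn_foldr_cubePartial γ l ?_
        convert hu using 2
        simp
        ring
      rw [Pi.add_apply, Pi.single_eq_of_ne ha, add_zero]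
      refine (cubePartial_iterate_comm h2 i a).trans
        (cubePartial_iterate_congr a (ih hl.2 hil (hu.of_le ?_)) _)
      norm_cast
      simp

theorem cubePartial_mixedPartial {u : (Fin n → ℝ) → ℝ} (γ : Fin n → ℕ) (i : Fin n)
    (hu : ContDiffOn ℝ ((1 + ∑ j, γ j : ℕ) : WithTop ℕ∞) u (cube n)) :
    EqOn (cubePartial i (mixedPartial γ u)) (mixedPartial (γ + Pi.single i 1) u) (cube n) := by
  refine cubePartial_foldr γ i _ (List.nodup_finRange n) (List.mem_finRange i) ?_
  rwa [← List.ofFn_eq_map, List.sum_ofFn]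

theorem mixedPartial_zero (u : (Fin n → ℝ) → ℝ) : mixedPartial 0 u = u := by
  simp [mixedPartial]

theorem contDiffOn_mixedPartial {u : (Fin n → ℝ) → ℝ} (γ : Fin n → ℕ) {k : ℕ}
    (hu : ContDiffOn ℝ ((k + ∑ j, γ j : ℕ) : WithTop ℕ∞) u (cube n)) :
    ContDiffOn ℝ (k : WithTop ℕ∞) (mixedPartial γ u) (cube n) := by
  refine contDiffOn_foldr_cubePartial γ _ ?_
  rwa [← List.ofFn_eq_map, List.sum_ofFn]

/-! ### Bounds from the Hölder norm, and Taylor's formula. -/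

theorem HolderUnitBall.abs_mixedPartial_le {r : ℕ} {β : ℝ} {h : (Fin n → ℝ) → ℝ}
    (hh : HolderUnitBall r β h) {γ : Fin n → ℕ} (hγ : ∑ j, γ j ≤ r) {x : Fin n → ℝ}
    (hx : x ∈ cube n) : |mixedPartial γ h x| ≤ 1 := by
  rw [← ENNReal.ofReal_le_one]
  refine le_trans ?_ hh.2
  refine le_trans ?_ le_self_add
  refine le_trans ?_ (Finset.single_le_sum (fun _ _ => zero_le) (Finset.mem_range_succ_iff.2 hγ))
  refine le_trans ?_ (Finset.single_le_sum (a := γ) (fun _ _ => zero_le) (by simp))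
  exact le_iSup₂ (f := fun x (_ : x ∈ cube n) => ENNReal.ofReal |mixedPartial γ h x|) x hx

theorem HolderUnitBall.abs_mixedPartial_sub_le {r : ℕ} {β : ℝ} {h : (Fin n → ℝ) → ℝ}
    (hh : HolderUnitBall r β h) {γ : Fin n → ℕ} (hγ : ∑ j, γ j = r) {x y : Fin n → ℝ}
    (hx : x ∈ cube n) (hy : y ∈ cube n) :
    |mixedPartial γ h x - mixedPartial γ h y| ≤ ‖x - y‖ ^ β := by
  by_cases hxy : x = y
  · subst hxy
    simp only [sub_self, abs_zero]
    positivity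
  have hpos : 0 < ‖x - y‖ ^ β := Real.rpow_pos_of_pos (norm_pos_iff.2 (sub_ne_zero.2 hxy)) _
  rw [← div_le_one hpos, ← ENNReal.ofReal_le_one]
  refine le_trans ?_ hh.2
  refine le_trans ?_ le_add_self
  refine le_trans ?_ (le_iSup₂ (α := ENNReal) γ (by simp [hγ]))
  refine le_trans ?_ (le_iSup₂ (α := ENNReal) x hx)
  refine le_trans ?_ (le_iSup₂ (α := ENNReal) y hy)
  exact le_iSup (fun _ : x ≠ y =>
    ENNReal.ofReal (|mixedPartial γ h x - mixedPartial γ h y| / ‖x - y‖ ^ β)) hxy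

/-- All iterated partial derivatives up to order `r` exist and are bounded by `1` on the cube, and
those of order `r` are `β`-Hölder with constant `1`. -/
def HolderTower (β : ℝ) : ℕ → ((Fin n → ℝ) → ℝ) → Prop
  | 0, h => (∀ x ∈ cube n, |h x| ≤ 1) ∧ ∀ x ∈ cube n, ∀ y ∈ cube n, |h x - h y| ≤ ‖x - y‖ ^ β
  | r + 1, h => (∀ x ∈ cube n, |h x| ≤ 1) ∧ DifferentiableOn ℝ h (cube n) ∧
      ∀ i, HolderTower β r (cubePartial i h)

theorem HolderTower.abs_le {β : ℝ} {r : ℕ} {h : (Fin n → ℝ) → ℝ} (hh : HolderTower β r h)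
    {x : Fin n → ℝ} (hx : x ∈ cube n) : |h x| ≤ 1 := by
  cases r <;> exact hh.1 x hx

theorem HolderTower.congr {β : ℝ} {r : ℕ} {u v : (Fin n → ℝ) → ℝ} (hu : HolderTower β r u)
    (h : EqOn v u (cube n)) : HolderTower β r v := by
  induction r generalizing u v with
  | zero =>
    refine ⟨fun x hx => ?_, fun x hx y hy => ?_⟩
    · rw [h hx]
      exact hu.1 x hx
    · rw [h hx, h hy]
      exact hu.2 x hx y hy
  | succ r ih =>
    refine ⟨fun x hx => ?_, hu.2.1.congr h, fun i => ih (hu.2.2 i) (cubePartial_congr i h)⟩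
    rw [h hx]
    exact hu.1 x hx

/-- The tower takes derivatives in any order while the norm uses one fixed order;
`cubePartial_mixedPartial` reconciles the two. The tower suits induction on the order of smoothness.
-/
theorem HolderUnitBall.holderTower_mixedPartial {r : ℕ} {β : ℝ} {h : (Fin n → ℝ) → ℝ}
    (hh : HolderUnitBall r β h) (j : ℕ) (γ : Fin n → ℕ) (hγ : ∑ i, γ i + j = r) :
    HolderTower β j (mixedPartial γ h) := by
  induction j generalizing γ with
  | zero =>
    exact ⟨fun x hx => hh.abs_mixedPartial_le (by omega) hx,
      fun x hx y hy => hh.abs_mixedPartial_sub_le (by omega) hx hy⟩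
  | succ j ih =>
    have hc : ContDiffOn ℝ ((1 + ∑ i, γ i : ℕ) : WithTop ℕ∞) h (cube n) :=
      hh.1.of_le (by norm_cast; omega)
    refine ⟨fun x hx => hh.abs_mixedPartial_le (by omega) hx,
      (contDiffOn_mixedPartial (k := 1) γ hc).differentiableOn (by norm_num), fun i => ?_⟩
    refine (ih (γ + Pi.single i 1) ?_).congr (cubePartial_mixedPartial γ i hc)
    simp only [Pi.add_apply, Finset.sum_add_distrib, Finset.sum_pi_single', Finset.mem_univ, if_true]
    omega

theorem HolderUnitBall.holderTower {r : ℕ} {β : ℝ} {h : (Fin n → ℝ) → ℝ}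
    (hh : HolderUnitBall r β h) : HolderTower β r h := by
  have := hh.holderTower_mixedPartial r 0 (by simp)
  rwa [mixedPartial_zero] at this

theorem fderivWithin_cube_apply (h : (Fin n → ℝ) → ℝ) (x v : Fin n → ℝ) :
    fderivWithin ℝ h (cube n) x v = ∑ i, v i * cubePartial i h x := by
  have := LinearMap.pi_apply_eq_sum_univ (fderivWithin ℝ h (cube n) x).toLinearMap v
  simp only [ContinuousLinearMap.coe_coe, smul_eq_mul] at this
  rw [this]
  refine Finset.sum_congr rfl fun i _ => ?_
  congr 2
  ext j
  simp [Pi.single_apply, eq_comm]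

/-- Mean value inequality along a segment of the cube, for the difference from a function `p`. -/
theorem abs_sub_sub_le_of_segment {h : (Fin n → ℝ) → ℝ} (hd : DifferentiableOn ℝ h (cube n))
    {a x : Fin n → ℝ} (ha : a ∈ cube n) (hx : x ∈ cube n) {p p' : ℝ → ℝ} {C : ℝ}
    (hp : ∀ t, HasDerivAt p (p' t) t)
    (hC : ∀ t ∈ Icc (0 : ℝ) 1,
      |∑ i, (x - a) i * cubePartial i h (a + t • (x - a)) - p' t| ≤ C) :
    |h x - h a - (p 1 - p 0)| ≤ C := by
  have hmem : ∀ t ∈ Icc (0 : ℝ) 1, a + t • (x - a) ∈ cube n := fun t ht =>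
    (convex_cube n).add_smul_sub_mem ha hx ht
  have h1 : ∀ t ∈ Icc (0 : ℝ) 1, HasDerivWithinAt (fun t => h (a + t • (x - a)) - p t)
      (∑ i, (x - a) i * cubePartial i h (a + t • (x - a)) - p' t) (Icc 0 1) t := by
    intro t ht
    rw [← fderivWithin_cube_apply]
    refine HasDerivWithinAt.sub ?_ (hp t).hasDerivWithinAt
    refine (hd _ (hmem t ht)).hasFDerivWithinAt.comp_hasDerivWithinAt t ?_ hmem
    have := ((hasDerivAt_id t).smul_const (x - a)).const_add a
    simpa using this.hasDerivWithinAt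
  have h2 := norm_image_sub_le_of_norm_deriv_le_segment_01' h1
    (fun t ht => hC t (Ico_subset_Icc_self ht))
  simp only [one_smul, zero_smul, add_zero, add_sub_cancel, Real.norm_eq_abs] at h2
  convert h2 using 2
  ring

/-- A factor of a monomial: a coordinate of `ξ` or `1`. -/
def monoFactor (ξ : Fin n → ℝ) (o : Option (Fin n)) : ℝ := o.elim 1 ξ

theorem exists_prod_monoFactor_smul {r : ℕ} (w : Fin r → Option (Fin n)) : ∃ k : ℕ,
    ∀ (ξ : Fin n → ℝ) (t : ℝ),
      ∏ i, monoFactor (t • ξ) (w i) = t ^ k * ∏ i, monoFactor ξ (w i) := by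
  induction r with
  | zero => exact ⟨0, fun ξ t => by simp⟩
  | succ r ih =>
    obtain ⟨k, hk⟩ := ih (Fin.tail w)
    rcases hw : w 0 with _ | i
    · refine ⟨k, fun ξ t => ?_⟩
      have := hk ξ t
      simp only [Fin.prod_univ_succ, hw, monoFactor, Option.elim, one_mul] at *
      exact this
    · refine ⟨k + 1, fun ξ t => ?_⟩
      have := hk ξ t
      simp only [Fin.prod_univ_succ, hw, monoFactor, Option.elim, Pi.smul_apply, smul_eq_mul] at *
      simp only [Fin.tail] at this
      rw [this]
      ring

theorem abs_sum_mul_le {ξ v : Fin n → ℝ} {C : ℝ} (hv : ∀ i, |v i| ≤ C) :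
    |∑ i, ξ i * v i| ≤ n * (‖ξ‖ * C) := by
  refine (Finset.abs_sum_le_sum_abs _ _).trans ?_
  calc ∑ i, |ξ i * v i| ≤ ∑ _i : Fin n, ‖ξ‖ * C := by
        refine Finset.sum_le_sum fun i _ => ?_
        rw [abs_mul]
        exact mul_le_mul (norm_le_pi_norm ξ i) (hv i) (abs_nonneg _) (norm_nonneg _)
    _ = _ := by simp

/-- Expand the partial derivatives to one order less and integrate along the segment from `a`; the
mean value inequality stands in for the integral. Monomials are indexed by words of length `r`, with
`none` for the factor 1, so that all terms have the same number of factors; repeated monomials do no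
harm. -/
theorem HolderTower.exists_taylor {β : ℝ} (hβ : 0 ≤ β) {r : ℕ} :
    ∀ {h : (Fin n → ℝ) → ℝ}, HolderTower β r h → ∀ {a : Fin n → ℝ}, a ∈ cube n →
      ∃ c : (Fin r → Option (Fin n)) → ℝ, (∀ w, |c w| ≤ 1) ∧ ∀ x ∈ cube n,
        |h x - ∑ w, c w * ∏ k, monoFactor (x - a) (w k)| ≤ (n : ℝ) ^ r * ‖x - a‖ ^ (r + β) := by
  induction r with
  | zero =>
    intro h hh a ha
    refine ⟨fun _ => h a, fun _ => hh.1 a ha, fun x hx => ?_⟩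
    simpa using hh.2 x hx a ha
  | succ r ih =>
    intro h hh a ha
    choose c hc hcx using fun i => ih (hh.2.2 i) ha
    choose k hk using fun w : Fin r → Option (Fin n) => exists_prod_monoFactor_smul w
    -- Integrating t^k yields the divisor k + 1. The constant `h a` sits at the all-`none` word;
    -- other words beginning with `none` get coefficient 0.
    let c' : (Fin (r + 1) → Option (Fin n)) → ℝ := fun v =>
      (v 0).elim (if Fin.tail v = fun _ => none then h a else 0)
        fun i => c i (Fin.tail v) / (k (Fin.tail v) + 1)
    have hsum : ∀ ξ : Fin n → ℝ, ∑ v, c' v * ∏ i, monoFactor ξ (v i) =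
        h a + ∑ i, ∑ w, c i w / (k w + 1) * (ξ i * ∏ j, monoFactor ξ (w j)) := by
      intro ξ
      rw [← (Fin.consEquiv fun _ => Option (Fin n)).sum_comp, Fintype.sum_prod_type,
        Fintype.sum_option]
      have e : ∀ (o : Option (Fin n)) (w : Fin r → Option (Fin n)),
        (Fin.consEquiv fun _ : Fin (r + 1) => Option (Fin n)) (o, w) = Fin.cons o w :=
          fun _ _ => rfl
      simp only [e, c', Fin.cons_zero, Fin.tail_cons, Option.elim, Fin.prod_univ_succ, Fin.cons_succ,
        ite_mul, zero_mul, Finset.sum_ite_eq', Finset.mem_univ, if_true, monoFactor]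
      simp
    refine ⟨c', fun v => ?_, fun x hx => ?_⟩
    · simp only [c']
      rcases v 0 with _ | i
      · simp only [Option.elim]
        split_ifs
        · exact hh.1 a ha
        · simp
      · simp only [Option.elim]
        have h1 : (0 : ℝ) < (k (Fin.tail v) : ℝ) + 1 := by positivity
        rw [abs_div, abs_of_pos h1, div_le_one h1]
        have h2 := hc i (Fin.tail v)
        have h3 : (0 : ℝ) ≤ k (Fin.tail v) := by positivity
        linarith
    · rw [hsum]
      set ξ := x - a with hξ
      let p : ℝ → ℝ := fun t =>
        ∑ i, ∑ w, c i w / (k w + 1) * (ξ i * ∏ j, monoFactor ξ (w j)) * t ^ (k w + 1)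
      let p' : ℝ → ℝ := fun t => ∑ i, ξ i * ∑ w, c i w * ∏ j, monoFactor (t • ξ) (w j)
      have hp : ∀ t, HasDerivAt p (p' t) t := by
        intro t
        have h1 : ∀ i w, HasDerivAt
            (fun t : ℝ => c i w / (k w + 1) * (ξ i * ∏ j, monoFactor ξ (w j)) * t ^ (k w + 1))
            (ξ i * (c i w * ∏ j, monoFactor (t • ξ) (w j))) t := by
          intro i w
          have h2 := (hasDerivAt_pow (k w + 1) t).const_mul
            (c i w / (k w + 1) * (ξ i * ∏ j, monoFactor ξ (w j)))
          refine h2.congr_deriv ?_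
          rw [hk]
          have h3 : (k w : ℝ) + 1 ≠ 0 := by positivity
          push_cast
          field_simp
        have h4 : p' t = ∑ i, ∑ w, ξ i * (c i w * ∏ j, monoFactor (t • ξ) (w j)) := by
          simp only [p', Finset.mul_sum]
        rw [h4]
        exact HasDerivAt.fun_sum fun i _ => HasDerivAt.fun_sum fun w _ => h1 i w
      have h5 := abs_sub_sub_le_of_segment (C := (n : ℝ) ^ (r + 1) * ‖ξ‖ ^ ((r + 1 : ℕ) + β))
        hh.2.1 ha hx hp (by
          intro t ht
          have h6 : ∑ i, (x - a) i * cubePartial i h (a + t • (x - a)) - p' t =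
              ∑ i, ξ i * (cubePartial i h (a + t • ξ) -
                ∑ w, c i w * ∏ j, monoFactor (t • ξ) (w j)) := by
            simp only [p', mul_sub, Finset.sum_sub_distrib, hξ]
          rw [h6]
          have hmem : a + t • ξ ∈ cube n := (convex_cube n).add_smul_sub_mem ha hx ht
          refine (abs_sum_mul_le (C := (n : ℝ) ^ r * ‖ξ‖ ^ (r + β)) fun i => ?_).trans
            (le_of_eq ?_)
          · have h7 := hcx i _ hmem
            rw [add_sub_cancel_left] at h7
            refine h7.trans ?_
            have h8 : ‖t • ξ‖ ≤ ‖ξ‖ := by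
              rw [norm_smul, Real.norm_eq_abs, abs_of_nonneg ht.1]
              exact mul_le_of_le_one_left (norm_nonneg _) ht.2
            gcongr
          · have h9 : ((r + 1 : ℕ) : ℝ) + β = 1 + (r + β) := by
              push_cast
              ring
            rw [h9, Real.rpow_one_add' (norm_nonneg _) (by positivity)]
            ring)
      have h10 : p 1 - p 0 = ∑ i, ∑ w, c i w / (k w + 1) * (ξ i * ∏ j, monoFactor ξ (w j)) := by
        rw [show p 0 = 0 from Finset.sum_eq_zero fun i _ => Finset.sum_eq_zero fun w _ => by simp,
          sub_zero]
        simp only [p, one_pow, mul_one]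
      rw [h10] at h5
      rwa [← sub_sub]

theorem HolderTower.abs_sub_le {β : ℝ} (hβ : 0 < β) (hβ' : β ≤ 1) {r : ℕ} {h : (Fin n → ℝ) → ℝ}
    (hh : HolderTower β r h) {x y : Fin n → ℝ} (hx : x ∈ cube n) (hy : y ∈ cube n) :
    |h x - h y| ≤ (n + 1) * ‖x - y‖ ^ min (r + β) 1 := by
  cases r with
  | zero =>
    simp only [Nat.cast_zero, zero_add, min_eq_left hβ']
    refine (hh.2 x hx y hy).trans ?_
    have : 0 ≤ ‖x - y‖ ^ β := by positivity
    nlinarith [show (0 : ℝ) ≤ n by positivity]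
  | succ r =>
    have h1 : min (((r + 1 : ℕ) : ℝ) + β) 1 = 1 := by
      rw [min_eq_right]
      push_cast
      have : (0 : ℝ) ≤ r := by positivity
      linarith
    rw [h1, Real.rpow_one]
    have h2 := abs_sub_sub_le_of_segment (C := (n + 1) * ‖x - y‖) (p := 0) (p' := 0) hh.2.1 hy hx
      (fun t => hasDerivAt_const t 0) (by
        intro t ht
        rw [Pi.zero_apply, sub_zero]
        refine (abs_sum_mul_le (C := 1) fun i => (hh.2.2 i).abs_le
          ((convex_cube n).add_smul_sub_mem hy hx ht)).trans ?_
        have : 0 ≤ ‖x - y‖ := norm_nonneg _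
        linarith)
    simpa using h2

end

/-! ### Approximation of a Hölder function by a network -/

/-- The hat function of height `1` supported on `[-1,1]`. -/
def hat (y : ℝ) : ℝ := max 0 (y + 1) - 2 * max 0 y + max 0 (y - 1)

theorem hat_nonneg (y : ℝ) : 0 ≤ hat y := by
  unfold hat
  grind

theorem hat_le_one (y : ℝ) : hat y ≤ 1 := by
  unfold hat
  grind

theorem hat_eq_zero {y : ℝ} (hy : 1 ≤ |y|) : hat y = 0 := by
  unfold hat
  grind

/-- A hat is the difference of two consecutive unit ramps σ(y + 1) - σ(y), so the sum telescopes. -/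
theorem sum_hat {n : ℕ} {y : ℝ} (h0 : 0 ≤ y) (hn : y ≤ n) :
    ∑ p : Fin (n + 1), hat (y - (p : ℕ)) = 1 := by
  rw [Fin.sum_univ_eq_sum_range (fun p => hat (y - (p : ℕ))) (n + 1)]
  have h1 : ∀ p : ℕ, hat (y - p) = (max 0 (y - p + 1) - max 0 (y - p)) -
      (max 0 (y - (p + 1 : ℕ) + 1) - max 0 (y - (p + 1 : ℕ))) := by
    intro p
    unfold hat
    push_cast
    rw [show y - ((p : ℝ) + 1) + 1 = y - p by ring, show y - ((p : ℝ) + 1) = y - p - 1 by ring]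
    ring
  simp only [h1]
  rw [Finset.sum_range_sub' fun p : ℕ => max 0 (y - p + 1) - max 0 (y - p)]
  push_cast
  grind

theorem sum_indicator_hat_le {n : ℕ} {y : ℝ} (h0 : 0 ≤ y) :
    ∑ p : Fin n, (if |y - (p : ℕ)| < 1 then (1 : ℝ) else 0) ≤ 2 := by
  rw [Fin.sum_univ_eq_sum_range (fun p => if |y - (p : ℕ)| < 1 then (1 : ℝ) else 0) n,
    Finset.sum_ite, Finset.sum_const, Finset.sum_const_zero, nsmul_eq_mul, mul_one, add_zero]
  have h1 : (Finset.range n).filter (fun p : ℕ => |y - p| < 1) ⊆ {⌊y⌋₊, ⌊y⌋₊ + 1} := by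
    intro p hp
    have h2 := abs_lt.1 (Finset.mem_filter.1 hp).2
    have h3 : p < ⌊y⌋₊ + 2 := by
      have : (p : ℝ) < (⌊y⌋₊ + 2 : ℕ) := by
        push_cast
        linarith [Nat.lt_floor_add_one y]
      exact_mod_cast this
    have h4 : ⌊y⌋₊ < p + 1 := by
      have : (⌊y⌋₊ : ℝ) < (p + 1 : ℕ) := by
        push_cast
        linarith [Nat.floor_le h0]
      exact_mod_cast this
    simp only [Finset.mem_insert, Finset.mem_singleton]
    omega
  exact_mod_cast (Finset.card_le_card h1).trans Finset.card_le_two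

theorem prod_extend_one {ι κ : Type} [Fintype ι] [Fintype κ] {e : ι → κ} (he : e.Injective)
    (f : ι → ℝ) : ∏ k, Function.extend e f 1 k = ∏ i, f i := by
  symm
  refine Finset.prod_of_injOn e he.injOn (by simp) ?_ ?_
  · intro k _ hk
    rw [Function.extend_apply' _ _ _ (by simpa using hk), Pi.one_apply]
  · intro i _
    rw [he.extend_apply]

/-- `f` is a combination of three ridge functions `σ (N * (s · x + b))`, with bounded data. -/
def RidgeCombination {d : ℕ} (N : ℕ) (f : (Fin d → ℝ) → ℝ) : Prop :=
  ∃ (c : Fin 3 → ℝ) (s : Fin 3 → Fin d → ℝ) (b : Fin 3 → ℝ), ∑ h, c h ^ 2 ≤ 6 ∧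
    (∀ h, ∑ t, s h t ^ 2 ≤ 1) ∧ (∀ h, |b h| ≤ 2) ∧
      ∀ x, f x = ∑ h, c h * max 0 ((N : ℝ) * (∑ t, s h t * x t + b h))

/-! ### Hats and coordinates on the grid as leaves of the product trees. -/

section

variable {d N : ℕ}

theorem ridgeCombination_one (hN : 0 < N) : RidgeCombination N fun _ : Fin d → ℝ => 1 := by
  have hN' : (0 : ℝ) < N := by exact_mod_cast hN
  have h1 : (1 : ℝ) / N ≤ 1 := by
    rw [div_le_one hN']
    exact_mod_cast hN
  refine ⟨![1, 0, 0], 0, fun _ => 1 / N, ?_, by simp, fun _ => ?_, fun x => ?_⟩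
  · simp [Fin.sum_univ_three]
  · rw [abs_of_pos (by positivity)]
    linarith
  · simp [Fin.sum_univ_three, hN'.ne']

/-- The grid point `-1 + p / N`. -/
noncomputable def gridPoint (N p : ℕ) : ℝ := -1 + p / N

theorem abs_gridPoint_le (hN : 0 < N) {p : ℕ} (hp : p < 2 * N + 1) : |gridPoint N p| ≤ 1 := by
  have hN' : (0 : ℝ) < N := by exact_mod_cast hN
  have h1 : (p : ℝ) / N ≤ 2 := by
    rw [div_le_iff₀ hN']
    exact_mod_cast Nat.lt_succ_iff.1 hp
  have h2 : (0 : ℝ) ≤ p / N := by positivity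
  rw [gridPoint, abs_le]
  constructor <;> linarith

theorem ridgeCombination_hat (hN : 0 < N) {p : ℕ} (hp : p < 2 * N + 1) (i : Fin d) :
    RidgeCombination N fun x : Fin d → ℝ => hat (N * (x i + 1) - p) := by
  have hN' : (0 : ℝ) < N := by exact_mod_cast hN
  have h1 : (1 : ℝ) / N ≤ 1 := by
    rw [div_le_one hN']
    exact_mod_cast hN
  have h2 := abs_le.1 (abs_gridPoint_le hN hp)
  have h3 : (0 : ℝ) < 1 / N := by positivity
  refine ⟨![1, -2, 1], fun _ => Pi.single i 1,
    fun h => -gridPoint N p + (![1 / N, 0, -(1 / N)] : Fin 3 → ℝ) h, ?_, fun _ => ?_, fun h => ?_, fun x => ?_⟩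
  · simp [Fin.sum_univ_three]
    norm_num
  · simp [Pi.single_apply]
  · rw [abs_le]
    rw [one_div] at h1 h3
    fin_cases h <;> simp <;> constructor <;> linarith
  · simp only [Pi.single_apply, ite_mul, one_mul, zero_mul, Finset.sum_ite_eq', Finset.mem_univ,
      if_true, Fin.sum_univ_three, hat, gridPoint]
    simp only [Matrix.cons_val_zero, Matrix.cons_val_one, Matrix.cons_val, one_mul, neg_mul]
    have e1 : (N : ℝ) * (x i + (-(-1 + p / N) + 1 / N)) = N * (x i + 1) - p + 1 := by
      field_simp
      ring
    have e2 : (N : ℝ) * (x i + (-(-1 + p / N) + 0)) = N * (x i + 1) - p := by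
      field_simp
      ring
    have e3 : (N : ℝ) * (x i + (-(-1 + p / N) + -(1 / N))) = N * (x i + 1) - p - 1 := by
      field_simp
      ring
    rw [e1, e2, e3]
    ring

/-- The factor 1/2 keeps the leaf in [-1,1], as the gates require, since two points of [-1,1] may be
2 apart. -/
theorem ridgeCombination_coord (hN : 0 < N) {p : ℕ} (hp : p < 2 * N + 1) (i : Fin d) :
    RidgeCombination N fun x : Fin d → ℝ => (1 / 2) * (x i - gridPoint N p) := by
  have hN' : (0 : ℝ) < N := by exact_mod_cast hN
  have h1 : (1 : ℝ) / N ≤ 1 := by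
    rw [div_le_one hN']
    exact_mod_cast hN
  have h2 := abs_le.1 (abs_gridPoint_le hN hp)
  have h3 : (0 : ℝ) < 1 / N := by positivity
  refine ⟨![1 / (2 * N), -(1 / (2 * N)), 0], fun h => (![1, -1, 0] : Fin 3 → ℝ) h • Pi.single i 1,
    ![-gridPoint N p, gridPoint N p, 0], ?_, fun h => ?_, fun h => ?_, fun x => ?_⟩
  · have e : 1 / (2 * (N : ℝ)) = 1 / N / 2 := by field_simp
    rw [e]
    simp only [Fin.sum_univ_three, Matrix.cons_val_zero, Matrix.cons_val_one, Matrix.cons_val]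
    nlinarith
  · fin_cases h <;> simp [Pi.single_apply]
  · rw [abs_le]
    fin_cases h <;> simp <;> constructor <;> linarith
  · simp only [Pi.smul_apply, Pi.single_apply, smul_eq_mul, mul_ite, mul_one, mul_zero, ite_mul,
      zero_mul, Finset.sum_ite_eq', Finset.mem_univ, if_true, Fin.sum_univ_three]
    simp only [Matrix.cons_val_zero, Matrix.cons_val_one, Matrix.cons_val]
    rcases le_total 0 (x i - gridPoint N p) with h | h
    · rw [max_eq_right (by nlinarith), max_eq_left (by nlinarith)]
      field_simp
      ring
    · rw [max_eq_left (by nlinarith), max_eq_right (by nlinarith)]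
      field_simp
      ring

theorem sum_prod_grid (F : ℝ → ℝ) (x : Fin d → ℝ) :
    ∑ p : Fin d → Fin (2 * N + 1), ∏ i, F (N * (x i + 1) - (p i : ℕ)) =
      ∏ i, ∑ p : Fin (2 * N + 1), F (N * (x i + 1) - (p : ℕ)) := by
  rw [Finset.prod_univ_sum, Fintype.piFinset_univ]

theorem abs_sub_sum_hat_mul_le {x : Fin d → ℝ} (hx : x ∈ cube d) {y E : ℝ}
    {P : (Fin d → Fin (2 * N + 1)) → ℝ}
    (hP : ∀ p, (∀ i, |N * (x i + 1) - (p i : ℕ)| < 1) → |y - P p| ≤ E) :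
    |y - ∑ p, (∏ i, hat (N * (x i + 1) - (p i : ℕ))) * P p| ≤ E := by
  have hx1 := mem_cube_iff.1 hx
  have hpart : ∑ p : Fin d → Fin (2 * N + 1), ∏ i, hat (N * (x i + 1) - (p i : ℕ)) = 1 := by
    rw [sum_prod_grid]
    refine Finset.prod_eq_one fun i _ => sum_hat ?_ ?_
    · exact mul_nonneg (by positivity) (by linarith [(abs_le.1 (hx1 i)).1])
    · push_cast
      nlinarith [(abs_le.1 (hx1 i)).2, show (0 : ℝ) ≤ N by positivity]
  have e1 : y - ∑ p, (∏ i, hat (N * (x i + 1) - (p i : ℕ))) * P p =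
      ∑ p, (∏ i, hat (N * (x i + 1) - (p i : ℕ))) * (y - P p) := by
    simp only [mul_sub, Finset.sum_sub_distrib, ← Finset.sum_mul, hpart, one_mul]
  rw [e1]
  refine (Finset.abs_sum_le_sum_abs _ _).trans ?_
  rw [show E = (∑ p : Fin d → Fin (2 * N + 1), ∏ i, hat (N * (x i + 1) - (p i : ℕ))) * E by
    rw [hpart, one_mul], Finset.sum_mul]
  refine Finset.sum_le_sum fun p _ => ?_
  have h0 : 0 ≤ ∏ i, hat (N * (x i + 1) - (p i : ℕ)) :=
    Finset.prod_nonneg fun i _ => hat_nonneg _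
  rw [abs_mul, abs_of_nonneg h0]
  by_cases hp : ∀ i, |N * (x i + 1) - (p i : ℕ)| < 1
  · exact mul_le_mul_of_nonneg_left (hP p hp) h0
  · push Not at hp
    obtain ⟨i, hi⟩ := hp
    rw [Finset.prod_eq_zero (Finset.mem_univ i) (hat_eq_zero hi), zero_mul, zero_mul]

/-- In each coordinate at most two grid points are closer than one mesh width, so at most `2 ^ d`
grid points contribute, whatever `N` is. -/
theorem abs_sum_mul_local_le {x : Fin d → ℝ} (hx : x ∈ cube d) {ω : Type} [Fintype ω] {δ : ℝ}
    (a u : (Fin d → Fin (2 * N + 1)) × ω → ℝ) {B : ω → ℝ} (ha : ∀ j, |a j| ≤ B j.2)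
    (hδ : 0 ≤ δ) (hu : ∀ j, |u j| ≤ δ)
    (h0 : ∀ j i, 1 ≤ |N * (x i + 1) - (j.1 i : ℕ)| → u j = 0) :
    |∑ j, a j * u j| ≤ 2 ^ d * ((∑ v, B v) * δ) := by
  have hx1 := mem_cube_iff.1 hx
  have hind : ∑ p : Fin d → Fin (2 * N + 1),
      ∏ i, (if |N * (x i + 1) - (p i : ℕ)| < 1 then (1 : ℝ) else 0) ≤ 2 ^ d := by
    rw [sum_prod_grid fun y => if |y| < 1 then (1 : ℝ) else 0]
    refine (Finset.prod_le_prod (fun i _ => Finset.sum_nonneg fun p _ => ?_)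
      fun i _ => sum_indicator_hat_le ?_).trans (by simp)
    · split_ifs <;> norm_num
    · exact mul_nonneg (by positivity) (by linarith [(abs_le.1 (hx1 i)).1])
  refine (Finset.abs_sum_le_sum_abs _ _).trans ?_
  calc ∑ j, |a j * u j|
      ≤ ∑ j : (Fin d → Fin (2 * N + 1)) × ω,
          (∏ i, (if |N * (x i + 1) - (j.1 i : ℕ)| < 1 then (1 : ℝ) else 0)) * (B j.2 * δ) := by
        refine Finset.sum_le_sum fun j _ => ?_
        rw [abs_mul]
        by_cases hp : ∀ i, |N * (x i + 1) - (j.1 i : ℕ)| < 1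
        · simp only [hp, if_true, Finset.prod_const_one, one_mul]
          exact mul_le_mul (ha j) (hu j) (abs_nonneg _) ((abs_nonneg _).trans (ha j))
        · push Not at hp
          obtain ⟨i, hi⟩ := hp
          rw [h0 j i hi, Finset.prod_eq_zero (Finset.mem_univ i) (if_neg (not_lt.2 hi))]
          simp
    _ = (∑ p : Fin d → Fin (2 * N + 1),
          ∏ i, (if |N * (x i + 1) - (p i : ℕ)| < 1 then (1 : ℝ) else 0)) * ((∑ v, B v) * δ) := by
        rw [Fintype.sum_prod_type, Finset.sum_mul (s := Finset.univ), Finset.sum_mul]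
        refine Finset.sum_congr rfl fun p _ => ?_
        rw [Finset.mul_sum]
    _ ≤ 2 ^ d * ((∑ v, B v) * δ) := by
        refine mul_le_mul_of_nonneg_right hind (mul_nonneg (Finset.sum_nonneg fun v _ => ?_) hδ)
        exact (abs_nonneg _).trans (ha (fun _ => 0, v))

/-- The factors of the term of the approximation with grid index `j.1` and monomial `j.2`, placed
at the leaves of a binary tree and completed by ones. -/
noncomputable def leaf {r M : ℕ} (N : ℕ) (e : Fin d ⊕ Fin r ↪ (Fin M → Bool))
    (j : (Fin d → Fin (2 * N + 1)) × (Fin r → Option (Fin d))) (q : Fin M → Bool)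
    (x : Fin d → ℝ) : ℝ :=
  Function.extend e (Sum.elim (fun i => hat (N * (x i + 1) - (j.1 i : ℕ)))
    fun i => monoFactor ((1 / 2 : ℝ) • (x - fun i => gridPoint N (j.1 i))) (j.2 i)) 1 q

section

variable {r M : ℕ} (e : Fin d ⊕ Fin r ↪ (Fin M → Bool))
  (j : (Fin d → Fin (2 * N + 1)) × (Fin r → Option (Fin d)))

theorem leaf_inl (i : Fin d) (x : Fin d → ℝ) :
    leaf N e j (e (Sum.inl i)) x = hat (N * (x i + 1) - (j.1 i : ℕ)) := by
  rw [leaf, e.injective.extend_apply, Sum.elim_inl]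

theorem leaf_inr (i : Fin r) (x : Fin d → ℝ) : leaf N e j (e (Sum.inr i)) x =
    monoFactor ((1 / 2 : ℝ) • (x - fun i => gridPoint N (j.1 i))) (j.2 i) := by
  rw [leaf, e.injective.extend_apply, Sum.elim_inr]

theorem leaf_of_notMem {q : Fin M → Bool} (hq : ¬∃ y, e y = q) (x : Fin d → ℝ) :
    leaf N e j q x = 1 := by
  rw [leaf, Function.extend_apply' _ _ _ hq, Pi.one_apply]

theorem ridgeCombination_leaf (hN : 0 < N) (q : Fin M → Bool) :
    RidgeCombination N (leaf N e j q) := by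
  by_cases hq : ∃ y, e y = q
  · obtain ⟨y, rfl⟩ := hq
    rcases y with i | i
    · rw [funext (leaf_inl e j i)]
      exact ridgeCombination_hat hN (j.1 i).2 i
    · rw [funext (leaf_inr e j i)]
      rcases j.2 i with _ | t
      · exact ridgeCombination_one hN
      · exact ridgeCombination_coord hN (j.1 t).2 t
  · rw [funext (leaf_of_notMem e j hq)]
    exact ridgeCombination_one hN

theorem abs_leaf_le (hN : 0 < N) (q : Fin M → Bool) {x : Fin d → ℝ} (hx : x ∈ cube d) :
    |leaf N e j q x| ≤ 1 := by
  by_cases hq : ∃ y, e y = q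
  · obtain ⟨y, rfl⟩ := hq
    rcases y with i | i
    · rw [leaf_inl]
      exact abs_le.2 ⟨by linarith [hat_nonneg (N * (x i + 1) - (j.1 i : ℕ))], hat_le_one _⟩
    · rw [leaf_inr]
      rcases j.2 i with _ | t
      · simp [monoFactor]
      · have h1 := abs_le.1 (mem_cube_iff.1 hx t)
        have h2 := abs_le.1 (abs_gridPoint_le hN (j.1 t).2)
        simp only [monoFactor, Option.elim, Pi.smul_apply, Pi.sub_apply, smul_eq_mul]
        rw [abs_le]
        constructor <;> linarith
  · rw [leaf_of_notMem e j hq, abs_one]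

theorem prod_leaf (x : Fin d → ℝ) : ∏ q, leaf N e j q x =
    (∏ i, hat (N * (x i + 1) - (j.1 i : ℕ))) *
      ∏ i, monoFactor ((1 / 2 : ℝ) • (x - fun i => gridPoint N (j.1 i))) (j.2 i) := by
  simp only [leaf, prod_extend_one e.injective, Fintype.prod_sum_type, Sum.elim_inl, Sum.elim_inr]

end

theorem norm_sub_gridPoint_le (hN : 0 < N) {x : Fin d → ℝ} {p : Fin d → Fin (2 * N + 1)}
    (hp : ∀ i, |N * (x i + 1) - (p i : ℕ)| < 1) :
    ‖x - fun i => gridPoint N (p i)‖ ≤ (N : ℝ)⁻¹ := by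
  have hN0 : (0 : ℝ) < N := by exact_mod_cast hN
  rw [pi_norm_le_iff_of_nonneg (by positivity)]
  intro i
  have e2 : (x - fun i => gridPoint N (p i)) i = (N * (x i + 1) - (p i : ℕ)) * (N : ℝ)⁻¹ := by
    simp only [Pi.sub_apply, gridPoint]
    field_simp
    ring
  rw [e2, Real.norm_eq_abs, abs_mul, abs_of_pos (inv_pos.2 hN0)]
  exact mul_le_of_le_one_left (by positivity) (hp i).le

theorem gridPoint_mem_cube (hN : 0 < N) (p : Fin d → Fin (2 * N + 1)) :
    (fun i => gridPoint N (p i)) ∈ cube d :=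
  mem_cube_iff.2 fun i => abs_gridPoint_le hN (p i).2

/-! ### The approximating block of one node. -/

theorem card_terms_le (hN : 0 < N) (r : ℕ) :
    (Fintype.card ((Fin d → Fin (2 * N + 1)) × (Fin r → Option (Fin d))) : ℝ) ≤
      3 ^ d * (d + 1) ^ r * (N : ℝ) ^ d := by
  have hN' : (1 : ℝ) ≤ N := by exact_mod_cast hN
  simp only [Fintype.card_prod, Fintype.card_fun, Fintype.card_fin, Fintype.card_option]
  push_cast
  have : (2 * (N : ℝ) + 1) ^ d ≤ (3 * N) ^ d := by
    gcongr
    linarith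
  rw [mul_pow] at this
  calc (2 * (N : ℝ) + 1) ^ d * (d + 1) ^ r ≤ 3 ^ d * N ^ d * (d + 1) ^ r := by gcongr
    _ = _ := by ring

/-- The network `clip (∑ a_j ∏~ leaf_j)` with layer norms of order `N ^ (d / 2 + 1 / (2 M + 3))`. -/
theorem unifNet_leaf {r M m w : ℕ} (hN : 0 < N) (hm : 0 < m)
    (e : Fin d ⊕ Fin r ↪ (Fin M → Bool)) {A C : ℝ}
    (hC : (24 * A ^ 2 + 80 * 2 ^ M + 9) * (3 ^ d * (d + 1) ^ r) ≤ C)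
    (a : (Fin d → Fin (2 * N + 1)) × (Fin r → Option (Fin d)) → ℝ) (ha : ∀ j, |a j| ≤ A)
    (hw : C * ((N : ℝ) ^ d * m) ≤ w) :
    UnifNet ((N : ℝ) ^ (1 / (2 * M + 3) : ℝ) * (C * √((N : ℝ) ^ d))) w (2 * M + 2) (Fin d)
      fun x (_ : Unit) => clip (∑ j, a j * treeProd (mulApprox m) M fun q => leaf N e j q x) := by
  have hN' : (1 : ℝ) ≤ N := by exact_mod_cast hN
  have hm' : (1 : ℝ) ≤ m := by exact_mod_cast hm
  set S : ℝ := 3 ^ d * (d + 1) ^ r with hS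
  have hS1 : 1 ≤ S := one_le_mul_of_one_le_of_one_le (one_le_pow₀ (by norm_num))
    (one_le_pow₀ (by linarith [show (0 : ℝ) ≤ d by positivity]))
  have hM1 : (1 : ℝ) ≤ 2 ^ M := one_le_pow₀ (by norm_num)
  have hNd : (1 : ℝ) ≤ (N : ℝ) ^ d := one_le_pow₀ hN'
  set n : ℝ := (N : ℝ) ^ d with hn
  set T : ℝ := 24 * A ^ 2 + 80 * 2 ^ M + 9 with hT
  have hA2 : 0 ≤ A ^ 2 := sq_nonneg A
  have hT89 : 89 ≤ T := by linarith
  have hC89 : 89 ≤ C := by nlinarith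
  have hTS : T * (S * n) ≤ C ^ 2 * n := by
    rw [← mul_assoc]
    gcongr
    nlinarith
  have hR2 : (C * √n) ^ 2 = C ^ 2 * n := by rw [mul_pow, Real.sq_sqrt (by positivity)]
  have hSn : 1 ≤ S * n := one_le_mul_of_one_le_of_one_le hS1 hNd
  have hJ := card_terms_le (d := d) hN r
  rw [← hS, ← hn] at hJ
  set J : ℝ := (Fintype.card ((Fin d → Fin (2 * N + 1)) × (Fin r → Option (Fin d))) : ℝ) with hJd
  set l : ℝ := (N : ℝ) ^ (1 / (2 * M + 3) : ℝ) with hl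
  have hl1 : 1 ≤ l := Real.one_le_rpow hN' (by positivity)
  -- The block has 2M + 3 matrices, so `l` is the share of the slope `N` borne by each.
  have hlN : l ^ (M + 1 + M + 2) = N := by
    rw [hl, ← Real.rpow_natCast, ← Real.rpow_mul (by positivity)]
    push_cast
    rw [show (1 : ℝ) / (2 * M + 3) * (M + 1 + M + 2) = 1 by field_simp; ring, Real.rpow_one]
  have hR3 : 3 ≤ C * √n := by
    have : 1 ≤ √n := Real.one_le_sqrt.2 hNd
    nlinarith
  have hw' : 8 * m * (2 ^ M * J) ≤ w := by
    refine le_trans ?_ hw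
    calc 8 * m * (2 ^ M * J) ≤ 8 * m * (2 ^ M * (S * n)) := by gcongr
      _ = (8 * 2 ^ M * S) * (n * m) := by ring
      _ ≤ C * (n * m) := by
          have : 8 * 2 ^ M * S ≤ T * S := by
            gcongr
            linarith
          have h2 : 0 ≤ n * m := by positivity
          exact mul_le_mul_of_nonneg_right (this.trans hC) h2
  have hw4 : (4 : ℝ) ≤ w := by
    refine le_trans ?_ hw
    have : 1 ≤ n * m := one_le_mul_of_one_le_of_one_le hNd hm'
    nlinarith
  have ha2 : 24 * ∑ j, a j ^ 2 + 3 ≤ (C * √n) ^ 2 := by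
    have h1 : ∑ j, a j ^ 2 ≤ J * A ^ 2 := by
      rw [hJd, ← nsmul_eq_mul, ← Finset.card_univ]
      refine Finset.sum_le_card_nsmul _ _ _ fun j _ => ?_
      rw [← sq_abs]
      exact pow_le_pow_left₀ (abs_nonneg _) (ha j) 2
    have h2 : J * A ^ 2 ≤ S * n * A ^ 2 := by gcongr
    rw [hR2]
    refine le_trans ?_ hTS
    rw [hT]
    nlinarith
  have hRq : 80 * (2 ^ M * J) + 1 ≤ (C * √n) ^ 2 := by
    have h2 : (2 : ℝ) ^ M * J ≤ 2 ^ M * (S * n) := by gcongr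
    have h3 : 0 ≤ A ^ 2 * (S * n) := by positivity
    rw [hR2]
    refine le_trans ?_ hTS
    rw [hT]
    linarith
  choose cz sz bz hcz hsz hbz hzx using fun i : _ × (Fin M → Bool) =>
    ridgeCombination_leaf e i.1 hN i.2
  have h := unifNet_ridge hm hR3 hl1 (by exact_mod_cast hw4) M a ha2 M hRq
    (by rw [hJd] at hw'; exact_mod_cast hw') cz hcz sz hsz bz hbz
  rw [hlN, show M + 1 + M + 1 = 2 * M + 2 by ring] at h
  have hz : ∀ j q x, leaf N e j q x = _ := fun j q x => hzx (j, q) x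
  simp only [hz]
  exact h

/-- The error splits into that of the glued Taylor polynomials and that of the gates; `hM` ensures
that the factors of a term fit on the leaves of one tree. -/
theorem exists_block_approx {d r M : ℕ} {β : ℝ} (hβ : 0 ≤ β) (hM : d + r ≤ 2 ^ M) :
    ∃ C : ℝ, 1 ≤ C ∧ ∀ g : (Fin d → ℝ) → ℝ, HolderUnitBall r β g → ∀ N m : ℕ, 0 < N → 0 < m →
      ∃ φ : (Fin d → ℝ) → ℝ,
        (∀ w : ℕ, C * ((N : ℝ) ^ d * m) ≤ w →
          UnifNet ((N : ℝ) ^ (1 / (2 * M + 3) : ℝ) * (C * √((N : ℝ) ^ d))) w (2 * M + 2) (Fin d)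
            fun x (_ : Unit) => φ x) ∧
        (∀ x, |φ x| ≤ 1) ∧
        ∀ x ∈ cube d, |g x - φ x| ≤ C * ((N : ℝ) ^ (-(r + β)) + 1 / (m : ℝ) ^ 2) := by
  obtain ⟨e⟩ : Nonempty (Fin d ⊕ Fin r ↪ (Fin M → Bool)) :=
    Function.Embedding.nonempty_of_card_le (by simpa using hM)
  choose k hk using fun w : Fin r → Option (Fin d) => exists_prod_monoFactor_smul w
  set A : ℝ := ∑ w, 2 ^ k w with hA
  have hkA : ∀ w, (2 : ℝ) ^ k w ≤ A := fun w =>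
    Finset.single_le_sum (f := fun w => (2 : ℝ) ^ k w) (fun _ _ => by positivity)
      (Finset.mem_univ w)
  have hA0 : 0 ≤ A := Finset.sum_nonneg fun _ _ => by positivity
  set C₀ : ℝ := (24 * A ^ 2 + 80 * 2 ^ M + 9) * (3 ^ d * (d + 1) ^ r) with hC₀
  have hC₀1 : 0 ≤ C₀ := by positivity
  set C : ℝ := C₀ + (d : ℝ) ^ r + 2 ^ d * A * 2 ^ M + 1 with hC
  have h1C : (0 : ℝ) ≤ (d : ℝ) ^ r := by positivity
  have h2C : (0 : ℝ) ≤ 2 ^ d * A * 2 ^ M := by positivity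
  refine ⟨C, by linarith, fun g hg N m hN hm => ?_⟩
  have hN0 : (0 : ℝ) < N := by exact_mod_cast hN
  choose c hc hcx using fun p : Fin d → Fin (2 * N + 1) =>
    hg.holderTower.exists_taylor hβ (gridPoint_mem_cube hN p)
  -- The power of 2 undoes the halved coordinates in the leaves.
  let a : (Fin d → Fin (2 * N + 1)) × (Fin r → Option (Fin d)) → ℝ := fun j =>
    c j.1 j.2 * 2 ^ k j.2
  have ha : ∀ j, |a j| ≤ 2 ^ k j.2 := by
    intro j
    rw [abs_mul, abs_of_pos (show (0 : ℝ) < 2 ^ k j.2 by positivity)]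
    exact mul_le_of_le_one_left (by positivity) (hc _ _)
  refine ⟨fun x => clip (∑ j, a j * treeProd (mulApprox m) M fun q => leaf N e j q x),
    fun w hw => unifNet_leaf hN hm e (by linarith) a (fun j => (ha j).trans (hkA _)) hw,
    fun x => abs_clip_le _, fun x hx => ?_⟩
  have hY : ∑ j, a j * ∏ q, leaf N e j q x = ∑ p : Fin d → Fin (2 * N + 1),
      (∏ i, hat (N * (x i + 1) - (p i : ℕ))) *
        ∑ w, c p w * ∏ i, monoFactor (x - fun i => gridPoint N (p i)) (w i) := by
    rw [Fintype.sum_prod_type]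
    refine Finset.sum_congr rfl fun p _ => ?_
    rw [Finset.mul_sum]
    refine Finset.sum_congr rfl fun w _ => ?_
    rw [prod_leaf, hk]
    have h3 : (2 : ℝ) ^ k w * (1 / 2) ^ k w = 1 := by rw [← mul_pow]; norm_num
    linear_combination (c p w * (∏ i, hat (N * (x i + 1) - (p i : ℕ))) *
      ∏ i, monoFactor (x - fun i => gridPoint N (p i)) (w i)) * h3
  have h1 : |g x - ∑ j, a j * ∏ q, leaf N e j q x| ≤ (d : ℝ) ^ r * (N : ℝ) ^ (-(r + β)) := by
    rw [hY]
    refine abs_sub_sum_hat_mul_le hx fun p hp => (hcx p x hx).trans ?_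
    have h3 := norm_sub_gridPoint_le hN hp
    rw [Real.rpow_neg hN0.le, ← Real.inv_rpow hN0.le]
    gcongr
  have h2 : |∑ j, a j * ∏ q, leaf N e j q x -
      ∑ j, a j * treeProd (mulApprox m) M fun q => leaf N e j q x| ≤
        2 ^ d * (A * (2 ^ M / (m : ℝ) ^ 2)) := by
    simp only [← Finset.sum_sub_distrib, ← mul_sub]
    refine abs_sum_mul_local_le hx a _ ha (by positivity) (fun j => ?_) fun j i hi => ?_
    · rw [abs_sub_comm]
      exact abs_treeProd_sub_le hm M _ fun q => abs_leaf_le e j hN q hx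
    · have hz : leaf N e j (e (Sum.inl i)) x = 0 := by rw [leaf_inl, hat_eq_zero hi]
      rw [treeProd_eq_zero M (fun q => leaf N e j q x) _ hz,
        Finset.prod_eq_zero (f := fun q => leaf N e j q x) (Finset.mem_univ _) hz, sub_zero]
  -- Truncation does not increase the error, because |g| ≤ 1 on the cube.
  refine (abs_sub_clip_le _ (hg.holderTower.abs_le hx)).trans
    ((abs_sub_le _ _ _).trans ((add_le_add h1 h2).trans ?_))
  have h3 : (0 : ℝ) ≤ (N : ℝ) ^ (-(r + β)) := by positivity
  have h4 : (0 : ℝ) ≤ 1 / (m : ℝ) ^ 2 := by positivity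
  rw [mul_add]
  refine add_le_add (mul_le_mul_of_nonneg_right (by linarith) h3) ?_
  calc 2 ^ d * (A * (2 ^ M / (m : ℝ) ^ 2)) = 2 ^ d * A * 2 ^ M * (1 / (m : ℝ) ^ 2) := by ring
    _ ≤ _ := mul_le_mul_of_nonneg_right (by linarith) h4

end

/-! ### Propagation of errors through the graph -/

namespace LayeredDAG

variable {L : ℕ} {G : LayeredDAG L}

theorem parent_mem (ℓ : ℕ) (v : Fin (G.card (ℓ + 1))) (i : Fin (G.inDim ℓ v)) :
    G.parent ℓ v i ∈ G.parents ℓ v :=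
  Finset.orderEmbOfFin_mem _ _ _

theorem parent_injective (ℓ : ℕ) (v : Fin (G.card (ℓ + 1))) : (G.parent ℓ v).Injective :=
  ((G.parents ℓ v).orderEmbOfFin rfl).injective

theorem nodeValue_mem_cube {φ : G.NodeFunctions}
    (hφ : ∀ ℓ < L, ∀ v, ∀ y ∈ cube (G.inDim ℓ v), |φ ℓ v y| ≤ 1) {x : Fin (G.card 0) → ℝ}
    (hx : x ∈ cube (G.card 0)) {ℓ : ℕ} (hℓ : ℓ ≤ L) : G.nodeValue φ x ℓ ∈ cube (G.card ℓ) := by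
  induction ℓ with
  | zero => exact hx
  | succ ℓ ih =>
    rw [mem_cube_iff]
    intro v
    exact hφ ℓ hℓ v _ (mem_cube_iff.2 fun i => mem_cube_iff.1 (ih (by omega)) _)

theorem continuousOn_nodeValue {φ : G.NodeFunctions}
    (hφ : ∀ ℓ < L, ∀ v, ∀ y ∈ cube (G.inDim ℓ v), |φ ℓ v y| ≤ 1)
    (hc : ∀ ℓ < L, ∀ v, ContinuousOn (φ ℓ v) (cube (G.inDim ℓ v))) {ℓ : ℕ} (hℓ : ℓ ≤ L) :
    ContinuousOn (fun x => G.nodeValue φ x ℓ) (cube (G.card 0)) := by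
  induction ℓ with
  | zero => exact continuousOn_id
  | succ ℓ ih =>
    refine continuousOn_pi.2 fun v => (hc ℓ hℓ v).comp
      (f := fun x i => G.nodeValue φ x ℓ (G.parent ℓ v i)) ?_ fun x hx => ?_
    · exact continuousOn_pi.2 fun i => continuousOn_pi.1 (ih (by omega)) _
    · exact mem_cube_iff.2 fun i => mem_cube_iff.1 (nodeValue_mem_cube hφ hx (by omega)) _

theorem exists_isCriticalPath (hL : 1 ≤ L)
    (hpa : ∀ ℓ < L, ∀ v : Fin (G.card (ℓ + 1)), (G.parents ℓ v).Nonempty) (g φ : G.NodeFunctions)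
    (x : Fin (G.card 0) → ℝ) : ∃ π : G.NodePath, G.IsCriticalPath g φ x π := by
  obtain ⟨n, rfl⟩ : ∃ n, L = n + 1 := ⟨L - 1, by omega⟩
  have step : ∀ ℓ, ℓ < n → ∀ v : Fin (G.card (ℓ + 1 + 1)), ∃ u ∈ G.parents (ℓ + 1) v,
      ∀ u' ∈ G.parents (ℓ + 1) v, |G.nodeValue g x (ℓ + 1) u' - G.nodeValue φ x (ℓ + 1) u'| ≤
        |G.nodeValue g x (ℓ + 1) u - G.nodeValue φ x (ℓ + 1) u| := fun ℓ hℓ v =>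
    Finset.exists_max_image _ _ (hpa (ℓ + 1) (by omega) v)
  choose s hs hmax using step
  let π : ∀ ℓ, ℓ ≤ n → Fin (G.card (ℓ + 1)) := fun ℓ hℓ =>
    Nat.decreasingInduction (motive := fun k _ => Fin (G.card (k + 1))) (fun k hk v => s k hk v)
      G.out hℓ
  have hπ : ∀ ℓ (h : ℓ + 1 ≤ n), π ℓ (by omega) = s ℓ h (π (ℓ + 1) h) := fun ℓ h =>
    Nat.decreasingInduction_succ_left _ _ h (by omega)
  refine ⟨fun ℓ => π ℓ (Nat.lt_succ_iff.1 ℓ.2), fun ℓ h => ?_⟩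
  have h' : ℓ + 1 ≤ n := by omega
  simp only [hπ ℓ h']
  exact ⟨hs ℓ h' _, hmax ℓ h' _⟩

/-- The index `k` records the node of the path whose block error dominates so far. Passing to the
next node raises the bound to the power `min α 1`, which multiplies the exponent of `K` by one more
factor of the effective regularity. -/
theorem abs_nodeValue_sub_le {g φ : G.NodeFunctions} {C : ℝ} (hC : 1 ≤ C)
    (hg1 : ∀ ℓ < L, ∀ v, ∀ y ∈ cube (G.inDim ℓ v), |g ℓ v y| ≤ 1)
    (hφ1 : ∀ ℓ < L, ∀ v, ∀ y ∈ cube (G.inDim ℓ v), |φ ℓ v y| ≤ 1)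
    {α ρ : ∀ ℓ, Fin (G.card (ℓ + 1)) → ℝ} (hα : ∀ ℓ < L, ∀ v, 0 < α ℓ v)
    (hg : ∀ ℓ < L, ∀ v, ∀ y ∈ cube (G.inDim ℓ v), ∀ z ∈ cube (G.inDim ℓ v),
      |g ℓ v y - g ℓ v z| ≤ C * ‖y - z‖ ^ min (α ℓ v) 1)
    {K : ℝ} (hK : 0 < K)
    (hφ : ∀ ℓ < L, ∀ v, ∀ y ∈ cube (G.inDim ℓ v), |g ℓ v y - φ ℓ v y| ≤
      C * K ^ (-(2 * α ℓ v / ρ ℓ v)))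
    {x : Fin (G.card 0) → ℝ} (hx : x ∈ cube (G.card 0)) {π : G.NodePath}
    (hπ : G.IsCriticalPath g φ x π) (ℓ : ℕ) (hℓ : ℓ < L) :
    ∃ k : Fin L, k ≤ ⟨ℓ, hℓ⟩ ∧
      |G.nodeValue g x (ℓ + 1) (π ⟨ℓ, hℓ⟩) - G.nodeValue φ x (ℓ + 1) (π ⟨ℓ, hℓ⟩)| ≤
        (2 * C) ^ (ℓ + 1) * K ^ (-(2 * (α k (π k) *
          ∏ m ∈ Finset.Ioc k ⟨ℓ, hℓ⟩, min (α m (π m)) 1) / ρ k (π k))) := by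
  induction ℓ with
  | zero =>
    refine ⟨⟨0, hℓ⟩, le_rfl, ?_⟩
    rw [Finset.Ioc_self, Finset.prod_empty, mul_one, show (2 * C) ^ (0 + 1) = 2 * C by ring]
    refine (hφ 0 hℓ (π ⟨0, hℓ⟩) _ (mem_cube_iff.2 fun i => mem_cube_iff.1 hx _)).trans ?_
    refine mul_le_mul_of_nonneg_right (by linarith) (Real.rpow_nonneg hK.le _)
  | succ ℓ ih =>
    obtain ⟨k, hk, hE⟩ := ih (by omega)
    obtain ⟨-, hmax⟩ := hπ ℓ hℓ
    set v := π ⟨ℓ + 1, hℓ⟩ with hv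
    set E := |G.nodeValue g x (ℓ + 1) (π ⟨ℓ, by omega⟩) -
      G.nodeValue φ x (ℓ + 1) (π ⟨ℓ, by omega⟩)| with hEdef
    have hE0 : 0 ≤ E := abs_nonneg _
    set μ := min (α (ℓ + 1) v) 1 with hμ
    have hμ0 : 0 < μ := lt_min (hα _ hℓ _) one_pos
    have hμ1 : μ ≤ 1 := min_le_right _ _
    have hy : (fun i => G.nodeValue g x (ℓ + 1) (G.parent (ℓ + 1) v i)) ∈ cube _ :=
      mem_cube_iff.2 fun i => mem_cube_iff.1 (nodeValue_mem_cube hg1 hx hℓ.le) _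
    have hz : (fun i => G.nodeValue φ x (ℓ + 1) (G.parent (ℓ + 1) v i)) ∈ cube _ :=
      mem_cube_iff.2 fun i => mem_cube_iff.1 (nodeValue_mem_cube hφ1 hx hℓ.le) _
    have hdist : ‖(fun i => G.nodeValue g x (ℓ + 1) (G.parent (ℓ + 1) v i)) -
        fun i => G.nodeValue φ x (ℓ + 1) (G.parent (ℓ + 1) v i)‖ ≤ E :=
      (pi_norm_le_iff_of_nonneg hE0).2 fun i => hmax _ (parent_mem _ _ _)
    have hstep : |G.nodeValue g x (ℓ + 1 + 1) v - G.nodeValue φ x (ℓ + 1 + 1) v| ≤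
        C * E ^ μ + C * K ^ (-(2 * α (ℓ + 1) v / ρ (ℓ + 1) v)) := by
      refine (abs_sub_le _ (g (ℓ + 1) v fun i => G.nodeValue φ x (ℓ + 1) (G.parent (ℓ + 1) v i))
        _).trans (add_le_add ((hg _ hℓ v _ hy _ hz).trans ?_) (hφ _ hℓ v _ hz))
      gcongr
    set P := (2 * C) ^ (ℓ + 1) with hP
    have hP1 : 1 ≤ P := one_le_pow₀ (by linarith)
    set t := -(2 * (α k (π k) * ∏ m ∈ Finset.Ioc k ⟨ℓ, by omega⟩, min (α m (π m)) 1) / ρ k (π k))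
      with ht
    have hEμ : E ^ μ ≤ P * K ^ (t * μ) := by
      calc E ^ μ ≤ (P * K ^ t) ^ μ := by gcongr
        _ = P ^ μ * K ^ (t * μ) := by
          rw [Real.mul_rpow (by linarith) (Real.rpow_nonneg hK.le _), Real.rpow_mul hK.le]
        _ ≤ P ^ (1 : ℝ) * K ^ (t * μ) := by
          have : 0 ≤ K ^ (t * μ) := Real.rpow_nonneg hK.le _
          gcongr
        _ = _ := by rw [Real.rpow_one]
    have hins : Finset.Ioc k ⟨ℓ + 1, hℓ⟩ =
        insert ⟨ℓ + 1, hℓ⟩ (Finset.Ioc k (⟨ℓ, by omega⟩ : Fin L)) := by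
      ext m
      rw [Fin.le_def] at hk
      simp only [Finset.mem_Ioc, Finset.mem_insert, Fin.lt_def, Fin.le_def, Fin.ext_iff] at hk ⊢
      omega
    have htμ : -(2 * (α k (π k) * ∏ m ∈ Finset.Ioc k ⟨ℓ + 1, hℓ⟩, min (α m (π m)) 1) / ρ k (π k)) =
        t * μ := by
      rw [hins, Finset.prod_insert (by simp [Fin.lt_def]), ht]
      simp only [← hv, ← hμ]
      ring
    -- Either the inherited error dominates and `k` is kept, or the new block error does and `k`
    -- moves to the current node.
    rcases le_total (K ^ (-(2 * α (ℓ + 1) v / ρ (ℓ + 1) v))) (K ^ (t * μ)) with h | h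
    · refine ⟨k, hk.trans (by simp [Fin.le_def]), hstep.trans ?_⟩
      rw [htμ, pow_succ]
      have h1 : 0 ≤ K ^ (t * μ) := Real.rpow_nonneg hK.le _
      have h2 : C * E ^ μ ≤ C * (P * K ^ (t * μ)) := by gcongr
      have h3 : C * K ^ (-(2 * α (ℓ + 1) v / ρ (ℓ + 1) v)) ≤ C * (P * K ^ (t * μ)) := by
        gcongr
        nlinarith
      linarith
    · refine ⟨⟨ℓ + 1, hℓ⟩, le_rfl, hstep.trans ?_⟩
      rw [Finset.Ioc_self, Finset.prod_empty, mul_one, ← hv, pow_succ]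
      set κ := K ^ (-(2 * α (ℓ + 1) v / ρ (ℓ + 1) v)) with hκ
      have h1 : 0 ≤ κ := Real.rpow_nonneg hK.le _
      have h2 : C * E ^ μ ≤ C * (P * κ) := by
        gcongr
        exact hEμ.trans (by gcongr)
      have h3 : C * κ ≤ C * (P * κ) := by
        gcongr
        nlinarith
      linarith

theorem abs_compositional_sub_le {g φ : G.NodeFunctions} {C : ℝ} (hC : 1 ≤ C) (hL : 1 ≤ L)
    (hg1 : ∀ ℓ < L, ∀ v, ∀ y ∈ cube (G.inDim ℓ v), |g ℓ v y| ≤ 1)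
    (hφ1 : ∀ ℓ < L, ∀ v, ∀ y ∈ cube (G.inDim ℓ v), |φ ℓ v y| ≤ 1)
    {r : ∀ ℓ, Fin (G.card (ℓ + 1)) → ℕ}
    {α : ∀ ℓ, Fin (G.card (ℓ + 1)) → ℝ} (hα : ∀ ℓ < L, ∀ v, 0 < α ℓ v)
    (hg : ∀ ℓ < L, ∀ v, ∀ y ∈ cube (G.inDim ℓ v), ∀ z ∈ cube (G.inDim ℓ v),
      |g ℓ v y - g ℓ v z| ≤ C * ‖y - z‖ ^ min (α ℓ v) 1)
    {K : ℝ} (hK : 0 < K)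
    (hφ : ∀ ℓ < L, ∀ v, ∀ y ∈ cube (G.inDim ℓ v), |g ℓ v y - φ ℓ v y| ≤
      C * K ^ (-(2 * α ℓ v / G.denom r ℓ v)))
    {x : Fin (G.card 0) → ℝ} (hx : x ∈ cube (G.card 0)) {π : G.NodePath}
    (hπ : G.IsCriticalPath g φ x π) :
    |G.compositional g x - G.compositional φ x| ≤ (2 * C) ^ L * G.pathRate r α K π := by
  obtain ⟨n, rfl⟩ : ∃ n, L = n + 1 := ⟨L - 1, by omega⟩
  obtain ⟨k, -, hk⟩ := abs_nodeValue_sub_le hC hg1 hφ1 hα hg hK hφ hx hπ n (by omega)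
  have hout : G.out = π ⟨n, by omega⟩ := by
    have : Subsingleton (Fin (G.card (n + 1))) := by
      rw [G.card_top]
      infer_instance
    exact Subsingleton.elim _ _
  have hI : Finset.Ioc k (⟨n, by omega⟩ : Fin (n + 1)) = Finset.Ioi k := by
    ext m
    simp only [Finset.mem_Ioc, Finset.mem_Ioi, Fin.le_def, and_iff_left_iff_imp]
    intro _
    omega
  rw [hI] at hk
  unfold compositional
  rw [hout]
  refine hk.trans (mul_le_mul_of_nonneg_left ?_ (by positivity))
  exact le_ciSup (f := fun ℓ => K ^ (-(2 * G.effReg α π ℓ / G.denom r ℓ (π ℓ))))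
    (Set.finite_range _).bddAbove k

end LayeredDAG

/-! ### Assembly of the composed network -/

/-- The network whose parameters all vanish. -/
def ReLUNet.zero : (m D : ℕ) → ReLUNet 1 m D
  | _, 0 => .linear 0
  | _, D + 1 => .layer (n := 1) 0 0 (ReLUNet.zero 1 D)

theorem ReLUNet.realize_zero (m D : ℕ) (x : Fin m → ℝ) : (ReLUNet.zero m D).realize x = 0 := by
  induction D generalizing m with
  | zero => simp [ReLUNet.zero, ReLUNet.realize]
  | succ D ih => simp [ReLUNet.zero, ReLUNet.realize, ih]

theorem ReLUNet.kappa_zero (m D : ℕ) : (ReLUNet.zero m D).kappa = 0 := by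
  induction D generalizing m with
  | zero => simp [ReLUNet.zero, ReLUNet.kappa, frobNorm]
  | succ D ih => simp [ReLUNet.zero, ReLUNet.kappa, ih]

theorem ReLUNet.width_zero_le (m D : ℕ) : (ReLUNet.zero m D).width ≤ max m 1 := by
  induction D generalizing m with
  | zero => simp [ReLUNet.zero, ReLUNet.width]
  | succ D ih =>
    simp only [ReLUNet.zero, ReLUNet.width]
    exact max_le (le_max_left _ _) ((ih 1).trans (by simp))

theorem ReLUNet.continuous_realize {k m D : ℕ} (θ : ReLUNet k m D) : Continuous θ.realize := by
  induction θ with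
  | linear A => exact Continuous.matrix_mulVec continuous_const continuous_id
  | layer A b rest ih =>
    refine ih.comp (continuous_pi fun i => continuous_const.max ?_)
    exact ((continuous_apply i).comp
      (Continuous.matrix_mulVec continuous_const continuous_id)).add continuous_const

theorem UnifNet.exists_reLUNet {R : ℝ} (hR : 1 ≤ R) {w d D : ℕ} {φ : (Fin d → ℝ) → ℝ}
    (h : UnifNet R w D (Fin d) fun x (_ : Unit) => φ x) :
    ∃ θ : ReLUNet 1 d D, ∀ x, θ.realize x 0 = φ x := by
  obtain ⟨θ, -, -, hθ⟩ := (h.normNet hR).exists_reLUNet finOneEquiv.symm (Equiv.refl _)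
  exact ⟨θ, fun x => by rw [hθ]; rfl⟩

/-- Resolution `N` of the grid and width parameter `m` of the squares, for the budget `K`. -/
theorem exists_resolution {K α q : ℝ} (hK : 1 ≤ K) (hα : 0 < α) (hq : 0 < q) (d : ℕ) :
    ∃ N m : ℕ, 0 < N ∧ 0 < m ∧ (N : ℝ) ≤ K ^ (2 / q) ∧
      (N : ℝ) ^ d * m ≤ 2 * K ^ ((2 * d + α) / q) ∧
      (N : ℝ) ^ (-α) + 1 / (m : ℝ) ^ 2 ≤ (2 ^ α + 1) * K ^ (-(2 * α / q)) := by
  have hK0 : 0 < K := by linarith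
  set x := K ^ (2 / q) with hx
  have hx1 : 1 ≤ x := Real.one_le_rpow hK (by positivity)
  have hx0 : 0 < x := by linarith
  set y := x ^ (α / 2) with hy
  have hy1 : 1 ≤ y := Real.one_le_rpow hx1 (by positivity)
  have hN : 0 < ⌊x⌋₊ := Nat.floor_pos.2 hx1
  have hNx : (⌊x⌋₊ : ℝ) ≤ x := Nat.floor_le hx0.le
  -- Rounding down loses at most a factor 2, since x ≥ 1; this is the source of the constant `2 ^
  -- α`.
  have hN2 : x / 2 ≤ ⌊x⌋₊ := by
    have h1 := Nat.lt_floor_add_one x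
    have h2 : (1 : ℝ) ≤ ⌊x⌋₊ := by exact_mod_cast hN
    linarith
  have hm : 0 < ⌈y⌉₊ := Nat.ceil_pos.2 (by linarith)
  have hym : y ≤ ⌈y⌉₊ := Nat.le_ceil y
  have hm2 : (⌈y⌉₊ : ℝ) ≤ 2 * y := by linarith [Nat.ceil_lt_add_one (show 0 ≤ y by linarith)]
  have hxα : x ^ (-α) = K ^ (-(2 * α / q)) := by
    rw [hx, ← Real.rpow_mul hK0.le]
    congr 1
    ring
  refine ⟨⌊x⌋₊, ⌈y⌉₊, hN, hm, hNx, ?_, ?_⟩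
  · calc (⌊x⌋₊ : ℝ) ^ d * ⌈y⌉₊ ≤ x ^ d * (2 * y) := by gcongr
      _ = 2 * K ^ ((2 * d + α) / q) := by
        rw [hy, ← Real.rpow_natCast, mul_left_comm, ← Real.rpow_add hx0, hx,
          ← Real.rpow_mul hK0.le]
        congr 2
        field_simp
  · have h1 : (⌊x⌋₊ : ℝ) ^ (-α) ≤ 2 ^ α * x ^ (-α) := by
      calc (⌊x⌋₊ : ℝ) ^ (-α) ≤ (x / 2) ^ (-α) :=
            Real.rpow_le_rpow_of_nonpos (by positivity) hN2 (by linarith)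
        _ = _ := by
          rw [Real.div_rpow hx0.le (by norm_num), Real.rpow_neg (by norm_num : (0 : ℝ) ≤ 2)]
          field_simp
    have h2 : 1 / (⌈y⌉₊ : ℝ) ^ 2 ≤ x ^ (-α) := by
      have h3 : y ^ 2 = x ^ α := by
        rw [hy, ← Real.rpow_natCast, ← Real.rpow_mul hx0.le]
        congr 1
        push_cast
        ring
      rw [Real.rpow_neg hx0.le, ← h3, one_div]
      gcongr
    rw [← hxα]
    linarith

namespace LayeredDAG

variable {L : ℕ} {G : LayeredDAG L}

theorem card_pos (hpa : ∀ ℓ < L, ∀ v : Fin (G.card (ℓ + 1)), (G.parents ℓ v).Nonempty) {ℓ : ℕ}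
    (hℓ : ℓ ≤ L) : 0 < G.card ℓ := by
  refine Nat.decreasingInduction (motive := fun k _ => 0 < G.card k) (fun k hk h => ?_) ?_ hℓ
  · obtain ⟨u, -⟩ := hpa k hk ⟨0, h⟩
    exact u.pos
  · rw [G.card_top]
    exact one_pos

theorem exists_bound (f : ∀ ℓ, Fin (G.card (ℓ + 1)) → ℝ) :
    ∃ B : ℝ, 1 ≤ B ∧ ∀ ℓ < L, ∀ v, f ℓ v ≤ B := by
  have h0 : 0 ≤ ∑ ℓ ∈ Finset.range L, ∑ v, |f ℓ v| :=
    Finset.sum_nonneg fun _ _ => Finset.sum_nonneg fun _ _ => abs_nonneg _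
  refine ⟨1 + ∑ ℓ ∈ Finset.range L, ∑ v, |f ℓ v|, by linarith, fun ℓ hℓ v => ?_⟩
  have h1 := Finset.single_le_sum (f := fun v => |f ℓ v|) (fun _ _ => abs_nonneg _)
    (Finset.mem_univ v)
  have h2 := Finset.single_le_sum (f := fun ℓ => ∑ v, |f ℓ v|)
    (fun _ _ => Finset.sum_nonneg fun _ _ => abs_nonneg _) (Finset.mem_range.2 hℓ)
  linarith [le_abs_self (f ℓ v)]

theorem inDim_add_le_two_pow_maxLog (r : ∀ ℓ, Fin (G.card (ℓ + 1)) → ℕ) {ℓ : ℕ} (hℓ : ℓ < L)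
    (v : Fin (G.card (ℓ + 1))) : G.inDim ℓ v + r ℓ v ≤ 2 ^ G.maxLog r := by
  refine (Nat.le_pow_clog one_lt_two _).trans (Nat.pow_le_pow_right two_pos ?_)
  exact (Finset.le_sup (f := fun v => Nat.clog 2 (G.inDim ℓ v + r ℓ v)) (Finset.mem_univ v)).trans
    (Finset.le_sup (f := fun ℓ => Finset.univ.sup fun v => Nat.clog 2 (G.inDim ℓ v + r ℓ v))
      (Finset.mem_range.2 hℓ))

theorem denom_pos (hL : 1 ≤ L) (r : ∀ ℓ, Fin (G.card (ℓ + 1)) → ℕ) (ℓ : ℕ)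
    (v : Fin (G.card (ℓ + 1))) : 0 < G.denom r ℓ v := by
  have : (0 : ℝ) < L := by exact_mod_cast hL
  unfold denom
  positivity

theorem denom_eq (r : ∀ ℓ, Fin (G.card (ℓ + 1)) → ℕ) (ℓ : ℕ) (v : Fin (G.card (ℓ + 1))) :
    G.denom r ℓ v = L * (2 + (2 * G.maxLog r + 3) * G.inDim ℓ v) := by
  unfold denom depth
  push_cast
  ring

/-- Each level is one parallel network appended to the previous ones. The start is the identity
matrix on the inputs, whose Frobenius norm is bounded crudely by `G.card 0`. -/
theorem normNet_nodeValue {φ : G.NodeFunctions} {R S : ℝ} {w W B : ℕ} (hS : 1 ≤ S)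
    (hRS : ∀ ℓ < L, (G.card (ℓ + 1) : ℝ) * R ^ 2 ≤ S ^ 2)
    (hw : ∀ ℓ < L, G.card (ℓ + 1) * w ≤ W)
    (hφ : ∀ ℓ < L, ∀ v, UnifNet R w B (Fin (G.inDim ℓ v)) fun y (_ : Unit) => φ ℓ v y)
    (h0 : 0 < G.card 0) {ℓ : ℕ} (hℓ : ℓ ≤ L) :
    NormNet W (G.card 0 * (S ^ (B + 1)) ^ ℓ) (B * ℓ) (Fin (G.card 0))
      fun x => G.nodeValue φ x ℓ := by
  induction ℓ with
  | zero =>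
    have : Nonempty (Fin (G.card 0)) := ⟨⟨0, h0⟩⟩
    simpa [nodeValue] using normNet_id (w := W) (ι := Fin (G.card 0))
  | succ ℓ ih =>
    have h1 := UnifNet.parallel (w := fun _ => w) (by simpa using hRS ℓ hℓ) hS
      (fun v => parent_injective (G := G) ℓ v) (hφ ℓ hℓ)
    have h2 := h1.mono (by linarith) le_rfl (w' := W) (by simpa using hw ℓ hℓ)
    have h3 := (ih (by omega)).append hS h2
    rw [Nat.mul_succ, add_comm (B * ℓ), pow_succ _ ℓ, ← mul_assoc]
    exact h3

theorem compositional_mem_nnClass {φ : G.NodeFunctions} {W D : ℕ} {K : ℝ} (hW : G.card 0 ≤ W)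
    (h0 : 0 < G.card 0)
    (h : NormNet W K D (Fin (G.card 0)) fun x => G.nodeValue φ x L) :
    (fun x (_ : Fin 1) => G.compositional φ x) ∈ NNClass (G.card 0) 1 W D K := by
  obtain ⟨θ, h1, h2, h3⟩ := h.exists_reLUNet (finCongr G.card_top) (Equiv.refl _)
  refine ⟨θ, h1.trans (max_le hW (max_le le_rfl (by omega))), h2, ?_⟩
  funext x i
  rw [h3]
  have : (finCongr G.card_top).symm i = G.out := by
    rw [Equiv.symm_apply_eq]
    exact Subsingleton.elim _ _
  beta_reduce
  rw [this]
  rfl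

end LayeredDAG

/-- A block of resolution adapted to the budget `K`. -/
theorem exists_reLUNet_block {d r M L : ℕ} {α β C : ℝ} (hL : 1 ≤ L) (hβ : 0 < β)
    (hα : α = r + β) {c : ℕ}
    (hc : C ≤ c) (hC1 : 1 ≤ C) {g : (Fin d → ℝ) → ℝ}
    (hC : ∀ N m : ℕ, 0 < N → 0 < m →
      ∃ φ : (Fin d → ℝ) → ℝ,
        (∀ w : ℕ, C * ((N : ℝ) ^ d * m) ≤ w →
          UnifNet ((N : ℝ) ^ (1 / (2 * M + 3) : ℝ) * (C * √((N : ℝ) ^ d))) w (2 * M + 2) (Fin d)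
            fun x (_ : Unit) => φ x) ∧
        (∀ x, |φ x| ≤ 1) ∧
        ∀ x ∈ cube d, |g x - φ x| ≤ C * ((N : ℝ) ^ (-(r + β)) + 1 / (m : ℝ) ^ 2))
    {K q : ℝ} (hK : 1 ≤ K) (hq : q = L * (2 + (2 * M + 3) * d)) :
    ∃ (θ : ReLUNet 1 d (2 * M + 2)) (t : ℕ), (t : ℝ) ≤ 2 * c * K ^ ((2 * d + α) / q) ∧
      UnifNet (c * K ^ (1 / (L * (2 * M + 3)) : ℝ)) t (2 * M + 2) (Fin d)
        (fun x (_ : Unit) => θ.realize x 0) ∧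
      (∀ x, |θ.realize x 0| ≤ 1) ∧ ∀ x ∈ cube d, |g x - θ.realize x 0| ≤
        c * ((2 ^ α + 1) * K ^ (-(2 * α / q))) := by
  have hL0 : (0 : ℝ) < L := by exact_mod_cast hL
  have hK0 : 0 < K := by linarith
  have hq0 : 0 < q := by
    rw [hq]
    positivity
  have hα0 : 0 < α := by
    rw [hα]
    positivity
  have hc1 : (1 : ℝ) ≤ c := hC1.trans hc
  obtain ⟨N, m, hN, hm, hNK, hw, he⟩ := exists_resolution hK hα0 hq0 d
  have hN1 : (1 : ℝ) ≤ N := by exact_mod_cast hN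
  have hN0 : (0 : ℝ) < N := by linarith
  obtain ⟨φ, h1, h2, h3⟩ := hC N m hN hm
  have hwt : C * ((N : ℝ) ^ d * m) ≤ (c * (N ^ d * m) : ℕ) := by
    push_cast
    gcongr
  have hR1 : (1 : ℝ) ≤ c * K ^ (1 / (L * (2 * M + 3)) : ℝ) :=
    one_le_mul_of_one_le_of_one_le hc1 (Real.one_le_rpow hK (by positivity))
  have hR : (N : ℝ) ^ (1 / (2 * M + 3) : ℝ) * (C * √((N : ℝ) ^ d)) ≤
      c * K ^ (1 / (L * (2 * M + 3)) : ℝ) := by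
    have e1 : (N : ℝ) ^ (1 / (2 * M + 3) : ℝ) * √((N : ℝ) ^ d) =
        (N : ℝ) ^ (1 / (2 * M + 3) + d / 2 : ℝ) := by
      rw [Real.sqrt_eq_rpow, ← Real.rpow_natCast (N : ℝ) d, ← Real.rpow_mul hN0.le,
        ← Real.rpow_add hN0]
      congr 2
      ring
    calc (N : ℝ) ^ (1 / (2 * M + 3) : ℝ) * (C * √((N : ℝ) ^ d))
        = C * (N : ℝ) ^ (1 / (2 * M + 3) + d / 2 : ℝ) := by
          rw [← e1]
          ring
      _ ≤ c * (K ^ (2 / q)) ^ (1 / (2 * M + 3) + d / 2 : ℝ) := by gcongr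
      _ = _ := by
          -- By the form of `q`, the exponent (2/q)(1/(2M+3) + d/2) equals 1/(L(2M+3)): the
          -- in-degree cancels.
          rw [← Real.rpow_mul hK0.le, hq]
          congr 2
          field_simp
  have hu := (h1 _ hwt).mono (by positivity) hR le_rfl
  obtain ⟨θ, hθ⟩ := hu.exists_reLUNet hR1
  refine ⟨θ, c * (N ^ d * m), ?_, ?_, fun x => by rw [hθ]; exact h2 x, fun x hx => ?_⟩
  · push_cast
    rw [mul_comm 2 (c : ℝ), mul_assoc]
    gcongr
  · simpa only [hθ] using hu
  · rw [hθ]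
    refine (h3 x hx).trans ?_
    rw [← hα]
    gcongr

namespace LayeredDAG

variable {L : ℕ} {G : LayeredDAG L}

theorem compositional_eq_zero (hL : 1 ≤ L) {φ : G.NodeFunctions} (hφ : ∀ ℓ v y, φ ℓ v y = 0)
    (x : Fin (G.card 0) → ℝ) : G.compositional φ x = 0 := by
  obtain ⟨n, rfl⟩ : ∃ n, L = n + 1 := ⟨L - 1, by omega⟩
  exact hφ n _ _

/-- The class has sharp bounds `K` and `W`, while the construction loses constants. Using the budget
`K / K₀` shifts these losses into the error constant. -/
theorem exists_blocks (hL : 1 ≤ L)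
    (hpa : ∀ ℓ < L, ∀ v : Fin (G.card (ℓ + 1)), (G.parents ℓ v).Nonempty)
    (r : ∀ ℓ, Fin (G.card (ℓ + 1)) → ℕ)
    (β α : ∀ ℓ, Fin (G.card (ℓ + 1)) → ℝ)
    (hβ : ∀ ℓ < L, ∀ v, 0 < β ℓ v)
    (hα : ∀ ℓ < L, ∀ v, α ℓ v = (r ℓ v : ℝ) + β ℓ v) :
    ∃ c : ℝ, 1 ≤ c ∧ ∀ g : G.NodeFunctions,
      (∀ ℓ < L, ∀ v, HolderUnitBall (r ℓ v) (β ℓ v) (g ℓ v)) → ∀ K : ℝ, 1 ≤ K →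
      ∃ θ : ∀ ℓ (v : Fin (G.card (ℓ + 1))), ReLUNet 1 (G.inDim ℓ v) (G.blockDepth r),
        (∀ W : ℕ, G.card 0 ≤ W →
          (∀ ℓ < L, ∀ v : Fin (G.card (ℓ + 1)),
            K ^ ((2 * (G.inDim ℓ v : ℝ) + α ℓ v) / G.denom r ℓ v) ≤ (W : ℝ)) →
          (fun x (_ : Fin 1) => G.compositional (G.blockFunctions θ) x) ∈
            NNClass (G.card 0) 1 W (G.depth r) K) ∧
        (∀ ℓ < L, ∀ v y, |G.blockFunctions θ ℓ v y| ≤ 1) ∧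
        (∀ ℓ < L, ∀ v : Fin (G.card (ℓ + 1)), ∀ y ∈ cube (G.inDim ℓ v),
          |g ℓ v y - G.blockFunctions θ ℓ v y| ≤ c * K ^ (-(2 * α ℓ v / G.denom r ℓ v))) := by
  classical
  have hL0 : (0 : ℝ) < L := by exact_mod_cast hL
  have h0 := card_pos hpa (Nat.zero_le L)
  set M := G.maxLog r with hM
  have hα0 : ∀ ℓ < L, ∀ v, 0 < α ℓ v := fun ℓ hℓ v => by
    have := hβ ℓ hℓ v
    rw [hα ℓ hℓ]
    positivity
  have hblock := fun ℓ (hℓ : ℓ < L) v =>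
    exists_block_approx (hβ ℓ hℓ v).le (inDim_add_le_two_pow_maxLog r hℓ v)
  choose Cb hCb1 hCb using hblock
  obtain ⟨B₀, hB₀1, hB₀⟩ := exists_bound (G := G) fun ℓ v => if h : ℓ < L then Cb ℓ h v else 0
  have hCB : ∀ ℓ (h : ℓ < L) v, Cb ℓ h v ≤ ⌈B₀⌉₊ := fun ℓ h v => by
    have := hB₀ ℓ h v
    rw [dif_pos h] at this
    exact this.trans (Nat.le_ceil _)
  set c₁ := ⌈B₀⌉₊ with hc₁
  have hc₁1 : (1 : ℝ) ≤ c₁ := hB₀1.trans (Nat.le_ceil _)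
  set n := 1 + ∑ ℓ ∈ Finset.range L, G.card (ℓ + 1) with hn
  have hn1 : (1 : ℝ) ≤ n := by
    rw [hn]
    push_cast
    linarith [show (0 : ℝ) ≤ ∑ ℓ ∈ Finset.range L, (G.card (ℓ + 1) : ℝ) by positivity]
  have hcard : ∀ ℓ < L, G.card (ℓ + 1) ≤ n := fun ℓ hℓ =>
    (Finset.single_le_sum (f := fun ℓ => G.card (ℓ + 1)) (fun _ _ => Nat.zero_le _)
      (Finset.mem_range.2 hℓ)).trans (by omega)
  -- `K₁` is chosen so that its power with the width exponent exceeds the constant 2·n·c₁ lost in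
  -- the width; the summand `G.card 0 * P` of `K₀` pays for the norm.
  obtain ⟨K₁, hK₁1, hK₁⟩ := exists_bound (G := G) fun ℓ v =>
    (2 * (n * c₁ : ℝ)) ^ (1 / ((2 * (G.inDim ℓ v : ℝ) + α ℓ v) / G.denom r ℓ v))
  set P : ℝ := ((n : ℝ) * c₁) ^ ((2 * M + 3) * L) with hP
  have hnc : (1 : ℝ) ≤ n * c₁ := one_le_mul_of_one_le_of_one_le hn1 hc₁1
  have hP1 : 1 ≤ P := one_le_pow₀ hnc
  set K₀ : ℝ := K₁ + G.card 0 * P with hK₀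
  have hK₀1 : 1 ≤ K₀ := by
    have : 0 ≤ (G.card 0 : ℝ) * P := by positivity
    linarith
  have hK₀0 : 0 < K₀ := by linarith
  obtain ⟨B, hB1, hB⟩ := exists_bound (G := G) fun ℓ v =>
    (2 ^ α ℓ v + 1) * K₀ ^ (2 * α ℓ v / G.denom r ℓ v)
  refine ⟨c₁ * B, one_le_mul_of_one_le_of_one_le hc₁1 hB1, fun g hg K hK => ?_⟩
  have hK0 : 0 < K := by linarith
  -- For `K < K₀` the claimed error bound is at least 1, so zero blocks suffice.
  rcases lt_or_ge K K₀ with hKK | hKK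
  · have hzero : ∀ ℓ v y, G.blockFunctions
        (fun ℓ v => ReLUNet.zero (G.inDim ℓ v) (G.blockDepth r)) ℓ v y = 0 := fun ℓ v y => by
      simp [blockFunctions, ReLUNet.realize_zero]
    refine ⟨fun ℓ v => ReLUNet.zero _ _, fun W hW _ => ?_, fun ℓ _ v y => ?_, fun ℓ hℓ v y hy => ?_⟩
    · refine ⟨ReLUNet.zero _ _, (ReLUNet.width_zero_le _ _).trans (max_le hW (by omega)), ?_, ?_⟩
      · rw [ReLUNet.kappa_zero]
        exact hK0.le
      · funext x _
        rw [ReLUNet.realize_zero, compositional_eq_zero hL hzero]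
        rfl
    · rw [hzero]
      simp
    · rw [hzero, sub_zero]
      refine ((hg ℓ hℓ v).holderTower.abs_le hy).trans ?_
      have hq := denom_pos hL r ℓ v
      have ha := hα0 ℓ hℓ v
      have h1 : K ^ (2 * α ℓ v / G.denom r ℓ v) ≤ c₁ * B := by
        calc K ^ (2 * α ℓ v / G.denom r ℓ v) ≤ 1 * K₀ ^ (2 * α ℓ v / G.denom r ℓ v) := by
              rw [one_mul]
              gcongr
          _ ≤ (2 ^ α ℓ v + 1) * K₀ ^ (2 * α ℓ v / G.denom r ℓ v) := by
              gcongr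
              have : (0 : ℝ) ≤ 2 ^ α ℓ v := by positivity
              linarith
          _ ≤ B := hB ℓ hℓ v
          _ ≤ c₁ * B := by nlinarith
      rw [Real.rpow_neg hK0.le, ← div_eq_mul_inv, one_le_div (by positivity)]
      exact h1
  · set K' := K / K₀ with hK'
    have hK'1 : 1 ≤ K' := (one_le_div hK₀0).2 hKK
    have hex := fun ℓ (hℓ : ℓ < L) v => exists_reLUNet_block hL (hβ ℓ hℓ v) (hα ℓ hℓ v) (hCB ℓ hℓ v)
      (hCb1 ℓ hℓ v) (hCb ℓ hℓ v (g ℓ v) (hg ℓ hℓ v)) hK'1 (denom_eq r ℓ v)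
    choose θ t ht hθu hθ1 hθe using hex
    let Θ : ∀ ℓ (v : Fin (G.card (ℓ + 1))), ReLUNet 1 (G.inDim ℓ v) (G.blockDepth r) :=
      fun ℓ v => if h : ℓ < L then θ ℓ h v else ReLUNet.zero _ _
    have hΘ : ∀ ℓ (h : ℓ < L) v y, G.blockFunctions Θ ℓ v y = (θ ℓ h v).realize y 0 :=
      fun ℓ h v y => by
        have : Θ ℓ v = θ ℓ h v := dif_pos h
        rw [blockFunctions, this]
        rfl
    refine ⟨Θ, fun W hW hWK => ?_, fun ℓ hℓ v y => ?_, fun ℓ hℓ v y hy => ?_⟩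
    · set S : ℝ := n * c₁ * K' ^ (1 / (L * (2 * M + 3)) : ℝ) with hS
      have hKr : 1 ≤ K' ^ (1 / (L * (2 * M + 3)) : ℝ) := Real.one_le_rpow hK'1 (by positivity)
      have hS1 : 1 ≤ S := one_le_mul_of_one_le_of_one_le hnc hKr
      -- Each of the at most `n` blocks of a level gets an equal share of the width.
      have hnet := normNet_nodeValue (G := G) (φ := G.blockFunctions Θ) (W := W) (w := W / n)
        (R := c₁ * K' ^ (1 / (L * (2 * M + 3)) : ℝ)) (B := 2 * M + 2) hS1 ?_ ?_ ?_ h0 le_rfl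
      · have hdepth : G.depth r = (2 * M + 2) * L := by
          rw [depth]
          ring
        rw [hdepth]
        refine compositional_mem_nnClass hW h0 (hnet.mono ?_)
        have hpow : (S ^ (2 * M + 2 + 1)) ^ L = P * K' := by
          rw [← pow_mul, hS, mul_pow, hP]
          congr 1
          rw [← Real.rpow_natCast, ← Real.rpow_mul (by linarith)]
          push_cast
          rw [show (1 : ℝ) / (L * (2 * M + 3)) * ((2 * M + 2 + 1) * L) = 1 by field_simp; ring,
            Real.rpow_one]
        rw [hpow, hK', ← mul_assoc, mul_div_assoc', div_le_iff₀ hK₀0, mul_comm K]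
        have : (G.card 0 : ℝ) * P ≤ K₀ := by linarith
        gcongr
      · intro ℓ hℓ
        have h1 : (G.card (ℓ + 1) : ℝ) ≤ (n : ℝ) ^ 2 := by
          have : (G.card (ℓ + 1) : ℝ) ≤ n := by exact_mod_cast hcard ℓ hℓ
          nlinarith
        rw [hS, mul_assoc, mul_pow (n : ℝ)]
        gcongr
      · intro ℓ hℓ
        exact (Nat.mul_le_mul_right _ (hcard ℓ hℓ)).trans (Nat.mul_div_le _ _)
      · intro ℓ hℓ v
        simp only [hΘ ℓ hℓ]
        refine (hθu ℓ hℓ v).mono (by positivity) le_rfl ?_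
        rw [Nat.le_div_iff_mul_le (by omega)]
        have hq := denom_pos hL r ℓ v
        have ha := hα0 ℓ hℓ v
        set ε := (2 * (G.inDim ℓ v : ℝ) + α ℓ v) / G.denom r ℓ v with hε
        have hε0 : 0 < ε := by positivity
        have h1 : 2 * (n * c₁ : ℝ) ≤ K₀ ^ ε := by
          calc 2 * (n * c₁ : ℝ) = ((2 * (n * c₁ : ℝ)) ^ (1 / ε)) ^ ε := by
                rw [← Real.rpow_mul (by positivity), one_div, inv_mul_cancel₀ hε0.ne',
                  Real.rpow_one]
            _ ≤ K₀ ^ ε := by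
                have h2 : (2 * (n * c₁ : ℝ)) ^ (1 / ε) ≤ K₀ := by
                  have : 0 ≤ (G.card 0 : ℝ) * P := by positivity
                  have h4 : (2 * (n * c₁ : ℝ)) ^ (1 / ε) ≤ K₁ := hK₁ ℓ hℓ v
                  linarith
                gcongr
        have h3 : ((t ℓ hℓ v * n : ℕ) : ℝ) ≤ W := by
          push_cast
          calc (t ℓ hℓ v : ℝ) * n ≤ 2 * c₁ * K' ^ ε * n := by
                gcongr
                exact ht ℓ hℓ v
            _ = 2 * (n * c₁) * K' ^ ε := by ring
            _ ≤ K₀ ^ ε * K' ^ ε := by gcongr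
            _ = K ^ ε := by
                rw [← Real.mul_rpow hK₀0.le (by linarith), hK', mul_div_cancel₀ _ hK₀0.ne']
            _ ≤ W := hWK ℓ hℓ v
        exact_mod_cast h3
    · rw [hΘ ℓ hℓ]
      exact hθ1 ℓ hℓ v y
    · rw [hΘ ℓ hℓ]
      refine (hθe ℓ hℓ v y hy).trans ?_
      rw [mul_assoc]
      refine mul_le_mul_of_nonneg_left ?_ (by positivity)
      have h1 : K' ^ (-(2 * α ℓ v / G.denom r ℓ v)) =
          K₀ ^ (2 * α ℓ v / G.denom r ℓ v) * K ^ (-(2 * α ℓ v / G.denom r ℓ v)) := by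
        rw [hK', Real.div_rpow hK0.le hK₀0.le, Real.rpow_neg hK₀0.le, div_inv_eq_mul, mul_comm]
      rw [h1, ← mul_assoc]
      exact mul_le_mul_of_nonneg_right (hB ℓ hℓ v) (Real.rpow_nonneg hK0.le _)

end LayeredDAG

/-! ### The theorem. -/

theorem theorem2 (L : ℕ) (hL : 1 ≤ L) (G : LayeredDAG L)
    (hpa : ∀ ℓ < L, ∀ v : Fin (G.card (ℓ + 1)), (G.parents ℓ v).Nonempty)
    (r : ∀ ℓ, Fin (G.card (ℓ + 1)) → ℕ)
    (β α : ∀ ℓ, Fin (G.card (ℓ + 1)) → ℝ)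
    (hβ : ∀ ℓ < L, ∀ v, 0 < β ℓ v ∧ β ℓ v ≤ 1)
    (hα : ∀ ℓ < L, ∀ v, α ℓ v = (r ℓ v : ℝ) + β ℓ v) :
    -- the constant depends only on the graph and the smoothness indices
    ∃ c : ℝ, 0 < c ∧
      ∀ g : G.NodeFunctions,
        (∀ ℓ < L, ∀ v, HolderUnitBall (r ℓ v) (β ℓ v) (g ℓ v)) →
      ∀ K : ℝ, 1 ≤ K →
      -- one network block for each node
      ∃ θ : ∀ ℓ (v : Fin (G.card (ℓ + 1))), ReLUNet 1 (G.inDim ℓ v) (G.blockDepth r),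
        -- the composed network lies in the norm-constrained class, for every admissible width
        (∀ W : ℕ, G.card 0 ≤ W →
          (∀ ℓ < L, ∀ v : Fin (G.card (ℓ + 1)),
            K ^ ((2 * (G.inDim ℓ v : ℝ) + α ℓ v) / G.denom r ℓ v) ≤ (W : ℝ)) →
          (fun x (_ : Fin 1) => G.compositional (G.blockFunctions θ) x) ∈
            NNClass (G.card 0) 1 W (G.depth r) K) ∧
        -- each block approximates its node function
        (∀ ℓ < L, ∀ v : Fin (G.card (ℓ + 1)), ∀ y ∈ cube (G.inDim ℓ v),
          |g ℓ v y - G.blockFunctions θ ℓ v y| ≤ c * K ^ (-(2 * α ℓ v / G.denom r ℓ v))) ∧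
        -- error at a point, along every critical path of that point
        (∀ x ∈ cube (G.card 0), ∀ π : G.NodePath,
          G.IsCriticalPath g (G.blockFunctions θ) x π →
          |G.compositional g x - G.compositional (G.blockFunctions θ) x| ≤
            c * G.pathRate r α K π) ∧
        -- sup-norm error, along a critical path of a point where the sup norm is attained
        (∃ x₀ ∈ cube (G.card 0), ∃ π : G.NodePath,
          IsMaxOn (fun x => |G.compositional g x - G.compositional (G.blockFunctions θ) x|)
            (cube (G.card 0)) x₀ ∧
          G.IsCriticalPath g (G.blockFunctions θ) x₀ π ∧
          ∀ x ∈ cube (G.card 0),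
            |G.compositional g x - G.compositional (G.blockFunctions θ) x| ≤
              c * G.pathRate r α K π) := by
  obtain ⟨c, hc1, hc⟩ := LayeredDAG.exists_blocks hL hpa r β α (fun ℓ hℓ v => (hβ ℓ hℓ v).1) hα
  -- `B` bounds the Hölder constants of the node functions, which by `HolderTower.abs_sub_le` are at
  -- most the in-degree plus one.
  obtain ⟨B, hB1, hB⟩ := LayeredDAG.exists_bound (G := G) fun ℓ v => (G.inDim ℓ v : ℝ) + 1
  set C := c + B with hC
  have hC1 : 1 ≤ C := by linarith
  have hCL : C ≤ (2 * C) ^ L := by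
    calc C ≤ 2 * C := by linarith
      _ = (2 * C) ^ 1 := (pow_one _).symm
      _ ≤ (2 * C) ^ L := pow_le_pow_right₀ (by linarith) hL
  refine ⟨(2 * C) ^ L, by positivity, fun g hg K hK => ?_⟩
  have hK0 : 0 < K := by linarith
  obtain ⟨θ, hθ, hθ1, hθe⟩ := hc g hg K hK
  have hα0 : ∀ ℓ < L, ∀ v, 0 < α ℓ v := fun ℓ hℓ v => by
    have := (hβ ℓ hℓ v).1
    rw [hα ℓ hℓ]
    positivity
  have hg1 : ∀ ℓ < L, ∀ v, ∀ y ∈ cube (G.inDim ℓ v), |g ℓ v y| ≤ 1 := fun ℓ hℓ v y hy =>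
    (hg ℓ hℓ v).holderTower.abs_le hy
  have hφ1 : ∀ ℓ < L, ∀ v, ∀ y ∈ cube (G.inDim ℓ v), |G.blockFunctions θ ℓ v y| ≤ 1 :=
    fun ℓ hℓ v y _ => hθ1 ℓ hℓ v y
  have hglip : ∀ ℓ < L, ∀ v, ∀ y ∈ cube (G.inDim ℓ v), ∀ z ∈ cube (G.inDim ℓ v),
      |g ℓ v y - g ℓ v z| ≤ C * ‖y - z‖ ^ min (α ℓ v) 1 := fun ℓ hℓ v y hy z hz => by
    refine ((hg ℓ hℓ v).holderTower.abs_sub_le (hβ ℓ hℓ v).1 (hβ ℓ hℓ v).2 hy hz).trans ?_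
    rw [hα ℓ hℓ]
    have := hB ℓ hℓ v
    gcongr
    linarith
  have herr : ∀ ℓ < L, ∀ v, ∀ y ∈ cube (G.inDim ℓ v), |g ℓ v y - G.blockFunctions θ ℓ v y| ≤
      C * K ^ (-(2 * α ℓ v / G.denom r ℓ v)) := fun ℓ hℓ v y hy => by
    refine (hθe ℓ hℓ v y hy).trans ?_
    gcongr
    linarith
  have hpath : ∀ x ∈ cube (G.card 0), ∀ π : G.NodePath,
      G.IsCriticalPath g (G.blockFunctions θ) x π →
        |G.compositional g x - G.compositional (G.blockFunctions θ) x| ≤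
          (2 * C) ^ L * G.pathRate r α K π := fun x hx π hπ =>
    LayeredDAG.abs_compositional_sub_le hC1 hL hg1 hφ1 hα0 hglip hK0 herr hx hπ
  have hcg : ContinuousOn (fun x => G.compositional g x) (cube (G.card 0)) :=
    continuousOn_pi.1 (LayeredDAG.continuousOn_nodeValue hg1
      (fun ℓ hℓ v => (hg ℓ hℓ v).1.continuousOn) le_rfl) G.out
  have hcφ : ContinuousOn (fun x => G.compositional (G.blockFunctions θ) x) (cube (G.card 0)) :=
    continuousOn_pi.1 (LayeredDAG.continuousOn_nodeValue hφ1 (fun ℓ hℓ v =>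
      ((continuous_apply 0).comp (θ ℓ v).continuous_realize).continuousOn) le_rfl) G.out
  have hcompact : IsCompact (cube (G.card 0)) := isCompact_Icc
  -- The sup norm is attained by continuity on the compact cube, so the pointwise bound along any
  -- critical path at the maximizer bounds it.
  obtain ⟨x₀, hx₀, hmax⟩ := hcompact.exists_isMaxOn
    ⟨0, mem_cube_iff.2 fun i => by simp⟩ (hcg.sub hcφ).abs
  obtain ⟨π, hπ⟩ := LayeredDAG.exists_isCriticalPath hL hpa g (G.blockFunctions θ) x₀
  refine ⟨θ, hθ, fun ℓ hℓ v y hy => (herr ℓ hℓ v y hy).trans ?_, hpath, x₀, hx₀, π, hmax, hπ,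
    fun x hx => (hmax hx).trans (hpath x₀ hx₀ π hπ)⟩
  gcongr
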